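/- Let $\mathcal D$ be a multifusion category over $\mathbb C$: a $\mathbb C$-linear abelian rigid monoidal category with bilinear tensor product, finite-dimensional morphism spaces, finitely many isomorphism classes of simple objects ($\operatorname{Irr}(\mathcal D)$ denotes a set of representatives), and every object a finite direct sum of simple ones. The unit $\mathbf 1$ need not be simple, and $\mathcal D$ may in particular be a unitary multifusion category. **Tube spaces.** For $m_0,m_1,n_0,n_1\in\mathbb N$ let $\mathbf T^{m_0,m_1;n_0,n_1}$ be the vector space spanned by tube string-nets: around a hole, a left (red) arc with $m_0$ internal and $m_1$ external legs and a right (blue) arc with $n_0$ internal and $n_1$ external legs run from a lower to an upper vertical line, all edges being labelled by $\operatorname{Irr}(\mathcal D)$ and vertices by morphisms. With diagrams read upwards, legs directed from inside to outside and each piece of the net evaluated to a morphism, $$\mathbf T^{m_0,m_1;n_0,n_1}=\bigoplus \operatorname{Hom}\big(y,(\alpha\otimes v)\otimes\beta\big)\otimes\operatorname{Hom}\big(\alpha\otimes C,\,A\otimes\alpha'\big)\otimes\operatorname{Hom}\big(D\otimes\beta,\,\beta'\otimes B\big)\otimes\operatorname{Hom}\big((\alpha'\otimes u)\otimes\beta',x\big),$$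 the sum running over simple outer vertical edges $x,y$, inner vertical edges $u,v$, first and last arc segments $\alpha,\alpha',\beta,\beta'$, and legs $a_i,b_j$ (external) and $c_i,d_j$ (internal), where $A=a_{m_1}\otimes\cdots\otimes a_1$, $C=c_{m_0}\otimes\cdots\otimes c_1$, $B=b_1\otimes\cdots\otimes b_{n_1}$, $D=d_1\otimes\cdots\otimes d_{n_0}$. **Stacking.** Placing a diagram of $\mathbf T^{m,s;n,t}$ around one of $\mathbf T^{p,m;q,n}$ gives $0$ unless the labels $(u,v,c_i,d_j)$ of the inner circle of the first equal the labels $(x,y,a_i,b_j)$ of the outer circle of the second. If they agree, one composes the morphisms along the common edges, obtaining a diagram whose arc segments are tensor products $\alpha_1\otimes\alpha_2$ (red) and $\beta_2\otimes\beta_1$ (blue), and returns to simple edges by resolving the identity of each such segment as $\sum_k \iota_k\pi_k$ over simple summands (the parallel move). This is a bilinear map $\mathbf T^{m,s;n,t}\times\mathbf T^{p,m;q,n}\to\mathbf T^{p,s;q,t}$. Let $1_{m,n}\in\mathbf T^{m,m;n,n}$ be the sum, over all labels of the legs and vertical edges, of the diagrams whose arcs are labelled by $\mathbf 1$ (decomposed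 into simple summands) and whose legs and vertical edges run straight through. The bulk tube algebra $\mathbf{Tube}({}_{\mathcal D}\mathcal D_{\mathcal D})$ is $\bigoplus\operatorname{Hom}(y,(a\otimes v)\otimes b)\otimes\operatorname{Hom}((a\otimes u)\otimes b,x)$, over $a,b,x,y,u,v\in\operatorname{Irr}(\mathcal D)$, with the analogous stacking multiplication and unit. **Theorem.** For all $m,n,s,t\in\mathbb N$: 1. $\mathbf T^{m,m;n,n}$ is an associative unital $\mathbb C$-algebra under stacking, with unit $1_{m,n}$. 2. $\mathbf T^{m,s;n,t}$ is a left-$\mathbf T^{s,s;t,t}$ right-$\mathbf T^{m,m;n,n}$ bimodule, the actions being stacking on the outside and on the inside. Moreover, stacking of any three composable tubes is associative. 3. Stacking induces isomorphisms of bimodules $$\mathbf T^{m,s;n,t}\otimes_{\mathbf T^{m,m;n,n}}\mathbf T^{s,m;t,n}\cong\mathbf T^{s,s;t,t},\qquad \mathbf T^{s,m;t,n}\otimes_{\mathbf T^{s,s;t,t}}\mathbf T^{m,s;n,t}\cong\mathbf T^{m,m;n,n},$$ so that these bimodules form a Morita context. 4. $\mathbf T^{m,m;n,n}$ and $\mathbf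 T^{s,s;t,t}$ are Morita equivalent: their module categories are $\mathbb C$-linearly equivalent. 5. $\mathbf T^{0,0;0,0}$ is the bulk tube algebra: regarding a legless edge $a$ (resp. $b$) as a red (resp. blue) arc without legs is an algebra isomorphism $\mathbf{Tube}({}_{\mathcal D}\mathcal D_{\mathcal D})\to\mathbf T^{0,0;0,0}$. Hence all $\mathbf T^{m,m;n,n}$ are Morita equivalent to the bulk tube algebra. -/

import Mathlib

open CategoryTheory MonoidalCategory TensorProduct

universe v u

noncomputable section

/-! ### Multifusion categories and their simple objects -/

/-- Isomorphism of simple objects. -/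
def simpleSetoid (D : Type u) [Category.{v} D] [Limits.HasZeroMorphisms D] :
    Setoid {X : D // Simple X} where
  r X Y := Nonempty (X.1 ≅ Y.1)
  iseqv :=
    { refl := fun X => ⟨Iso.refl X.1⟩
      symm := fun ⟨e⟩ => ⟨e.symm⟩
      trans := fun ⟨e⟩ ⟨f⟩ => ⟨e.trans f⟩ }

/-- `Irr(D)`: the isomorphism classes of simple objects. -/
def Irr (D : Type u) [Category.{v} D] [Limits.HasZeroMorphisms D] : Type u :=
  Quotient (simpleSetoid D)

/-- The representative of an isomorphism class of simple objects. -/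
def Irr.obj {D : Type u} [Category.{v} D] [Limits.HasZeroMorphisms D] (a : Irr D) : D :=
  (Quotient.out (s := simpleSetoid D) a).1

instance {D : Type u} [Category.{v} D] [Limits.HasZeroMorphisms D] : DecidableEq (Irr D) :=
  Classical.decEq _

attribute [local instance] Abelian.hasFiniteBiproducts

/-- A `ℂ`-linear abelian category with a bilinear rigid monoidal structure is a multifusion
category if its morphism spaces are finite-dimensional, every object is a finite direct sum of
simple objects, and there are finitely many isomorphism classes of simple objects. The tensor
unit is not required to be simple. -/
class IsMultifusion (D : Type u) [Category.{v} D] [Abelian D] [Linear ℂ D]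
    [MonoidalCategory D] [MonoidalPreadditive D] [MonoidalLinear ℂ D] [RigidCategory D] :
    Prop where
  finiteDimensional : ∀ X Y : D, FiniteDimensional ℂ (X ⟶ Y)
  semisimple : ∀ X : D, ∃ (n : ℕ) (S : Fin n → D), (∀ i, Simple (S i)) ∧ Nonempty (X ≅ ⨁ S)
  finite_irr : Finite (Irr D)

section

variable {D : Type u} [Category.{v} D] [Abelian D]

/-- A decomposition of the object `A` as a direct sum of members of `Irr(D)`. -/
structure SimpleDecomposition (A : D) where
  /-- the number of summands -/
  n : ℕ
  /-- the summands -/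
  label : Fin n → Irr D
  /-- the inclusions -/
  inj : ∀ i, (label i).obj ⟶ A
  /-- the projections -/
  proj : ∀ i, A ⟶ (label i).obj
  inj_proj_self : ∀ i, inj i ≫ proj i = 𝟙 _
  inj_proj_ne : ∀ i j, i ≠ j → inj i ≫ proj j = 0
  total : ∑ i, proj i ≫ inj i = 𝟙 A

variable [Linear ℂ D] [MonoidalCategory D] [MonoidalPreadditive D] [MonoidalLinear ℂ D]
  [RigidCategory D] [IsMultifusion D]

instance : Fintype (Irr D) :=
  haveI := IsMultifusion.finite_irr (D := D)
  Fintype.ofFinite _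

theorem nonempty_simpleDecomposition (A : D) : Nonempty (SimpleDecomposition A) := by
  obtain ⟨n, S, hS, ⟨e⟩⟩ := IsMultifusion.semisimple A
  let cls : Fin n → Irr D := fun i => Quotient.mk (simpleSetoid D) ⟨S i, hS i⟩
  have h : ∀ i, Nonempty ((cls i).obj ≅ S i) := fun i =>
    Quotient.mk_out (s := simpleSetoid D) (⟨S i, hS i⟩ : {X : D // Simple X})
  let f : ∀ i, (cls i).obj ≅ S i := fun i => (h i).some
  refine ⟨⟨n, cls, fun i => (f i).hom ≫ Limits.biproduct.ι S i ≫ e.inv,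
    fun i => e.hom ≫ Limits.biproduct.π S i ≫ (f i).inv, ?_, ?_, ?_⟩⟩
  · intro i
    simp
  · intro i j hij
    simp [Limits.biproduct.ι_π_ne_assoc S hij]
  · have : ∑ i, Limits.biproduct.π S i ≫ Limits.biproduct.ι S i = 𝟙 (⨁ S) :=
      Limits.biproduct.total
    calc _ = e.hom ≫ (∑ i, Limits.biproduct.π S i ≫ Limits.biproduct.ι S i) ≫ e.inv := by
            rw [Preadditive.sum_comp, Preadditive.comp_sum]
            simp
      _ = 𝟙 A := by rw [this]; simp

/-- A chosen decomposition of an object into simple objects. The results of the parallel moves below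
do not depend on the choice. -/
def simpleDecomposition (A : D) : SimpleDecomposition A :=
  (nonempty_simpleDecomposition A).some

end

/-! ### Tube diagrams -/

section

variable (D : Type u) [Category.{v} D] [Abelian D] [Linear ℂ D] [MonoidalCategory D]

/-- The labels on one of the two boundary circles of a tube with `m` red and `n` blue legs there:
the legs (numbered from top to bottom), and the vertical edge at the top and at the bottom. -/
@[ext] structure TubeBoundary (m n : ℕ) where
  /-- the red legs, on the left -/
  red : Fin m → Irr D
  /-- the blue legs, on the right -/
  blue : Fin n → Irr D
  /-- the upper vertical edge -/
  top : Irr D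
  /-- the lower vertical edge -/
  bot : Irr D

/-- The labels of the first and last segment of the red arc and of the blue arc. -/
@[ext] structure TubeArcs where
  /-- the red arc where it leaves the lower vertical edge -/
  redBot : Irr D
  /-- the red arc where it joins the upper vertical edge -/
  redTop : Irr D
  /-- the blue arc where it leaves the lower vertical edge -/
  blueBot : Irr D
  /-- the blue arc where it joins the upper vertical edge -/
  blueTop : Irr D

instance (m n : ℕ) : DecidableEq (TubeBoundary D m n) := Classical.decEq _
instance : DecidableEq (TubeArcs D) := Classical.decEq _

instance [MonoidalPreadditive D] [MonoidalLinear ℂ D] [RigidCategory D] [IsMultifusion D]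
    (m n : ℕ) : Fintype (TubeBoundary D m n) :=
  Fintype.ofInjective
    (fun b : TubeBoundary D m n => (b.red, b.blue, b.top, b.bot))
    (fun b c h => by
      simp only [Prod.mk.injEq] at h
      exact TubeBoundary.ext h.1 h.2.1 h.2.2.1 h.2.2.2)

variable {D}

/-- The product `a_m ⊗ (⋯ ⊗ a_1)` of red legs: after a leg leaving the red arc to the left is bent
upwards, the uppermost leg is next to the arc. -/
def redProd : (m : ℕ) → (Fin m → Irr D) → D
  | 0, _ => 𝟙_ D
  | m + 1, a => redProd m (fun i => a i.succ) ⊗ (a 0).obj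

/-- The product `b_1 ⊗ (⋯ ⊗ b_n)` of blue legs: after a leg leaving the blue arc to the right is
bent upwards, the uppermost leg is next to the arc. -/
def blueProd : (n : ℕ) → (Fin n → Irr D) → D
  | 0, _ => 𝟙_ D
  | n + 1, b => (b 0).obj ⊗ blueProd n (fun i => b i.succ)

/-- The product of the red legs on a boundary circle. -/
def TubeBoundary.redObj {m n : ℕ} (o : TubeBoundary D m n) : D := redProd m o.red

/-- The product of the blue legs on a boundary circle. -/
def TubeBoundary.blueObj {m n : ℕ} (o : TubeBoundary D m n) : D := blueProd n o.blue

variable {m₀ m₁ m₂ n₀ n₁ n₂ : ℕ}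

/-- Tube string-nets with external labels `o`, internal labels `i`, a red arc running from `A` at
the bottom to `A'` at the top, and a blue arc running from `B` to `B'`. Diagrams are read upwards
and the legs are directed from the inside to the outside. The four factors are
* the lower vertical line: the outer edge splits off `A` to the left and `B` to the right;
* the red arc, absorbing the internal red legs and emitting the external ones;
* the blue arc, absorbing the internal blue legs and emitting the external ones;
* the upper vertical line: the inner edge absorbs `A'` from the left and `B'` from the right. -/
abbrev TubeDiagram (A A' B B' : D) (o : TubeBoundary D m₁ n₁) (i : TubeBoundary D m₀ n₀) :
    Type v :=
  (o.bot.obj ⟶ (A ⊗ i.bot.obj) ⊗ B) ⊗[ℂ]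
    ((A ⊗ i.redObj ⟶ o.redObj ⊗ A') ⊗[ℂ]
      ((i.blueObj ⊗ B ⟶ B' ⊗ o.blueObj) ⊗[ℂ]
        ((A' ⊗ i.top.obj) ⊗ B' ⟶ o.top.obj)))

/-- The span of the tube string-nets with simple edges and prescribed boundary labels. -/
abbrev TubeBlock (o : TubeBoundary D m₁ n₁) (i : TubeBoundary D m₀ n₀) : Type (max u v) :=
  DirectSum (TubeArcs D) fun k =>
    TubeDiagram k.redBot.obj k.redTop.obj k.blueBot.obj k.blueTop.obj o i

variable (D) in
/-- The tube space `T^{m₀,m₁;n₀,n₁}`: `m₀` red internal, `m₁` red external, `n₀` blue internal and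
`n₁` blue external legs. It is the direct sum of the blocks over all boundary labels. -/
abbrev TubeSpace (m₀ m₁ n₀ n₁ : ℕ) : Type (max u v) :=
  (o : TubeBoundary D m₁ n₁) → (i : TubeBoundary D m₀ n₀) → TubeBlock o i

/-! ### Stacking diagrams -/

/-- Rebracketing two nested pairs of vertical strands around `V`. -/
def nestIso (A A₂ V B₂ B : D) :
    ((A ⊗ A₂) ⊗ V) ⊗ (B₂ ⊗ B) ≅ (A ⊗ ((A₂ ⊗ V) ⊗ B₂)) ⊗ B :=
  (α_ _ _ _).symm ≪≫ whiskerRightIso (whiskerRightIso (α_ _ _ _) _ ≪≫ α_ _ _ _) _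

variable [MonoidalPreadditive D] [MonoidalLinear ℂ D]

/-- Stacking of the lower vertical lines. -/
def botStack (A A₂ B₂ B y v' v : D) :
    (y ⟶ (A ⊗ v') ⊗ B) →ₗ[ℂ] (v' ⟶ (A₂ ⊗ v) ⊗ B₂) →ₗ[ℂ]
      (y ⟶ ((A ⊗ A₂) ⊗ v) ⊗ (B₂ ⊗ B)) :=
  LinearMap.mk₂ ℂ (fun p p₂ => p ≫ ((A ◁ p₂) ▷ B) ≫ (nestIso A A₂ v B₂ B).inv)
    (by intros; simp) (by intros; simp) (by intros; simp) (by intros; simp)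

/-- Stacking of the upper vertical lines. -/
def topStack (A A₂ B₂ B x u' u : D) :
    ((A ⊗ u') ⊗ B ⟶ x) →ₗ[ℂ] ((A₂ ⊗ u) ⊗ B₂ ⟶ u') →ₗ[ℂ]
      (((A ⊗ A₂) ⊗ u) ⊗ (B₂ ⊗ B) ⟶ x) :=
  LinearMap.mk₂ ℂ (fun q q₂ => (nestIso A A₂ u B₂ B).hom ≫ ((A ◁ q₂) ▷ B) ≫ q)
    (by intros; simp) (by intros; simp) (by intros; simp) (by intros; simp)

/-- Stacking of the red arcs along the legs `C`; the outer arc is on the left. -/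
def redStack (A A' A₂ A₂' E C C₂ : D) :
    (A ⊗ C ⟶ E ⊗ A') →ₗ[ℂ] (A₂ ⊗ C₂ ⟶ C ⊗ A₂') →ₗ[ℂ]
      ((A ⊗ A₂) ⊗ C₂ ⟶ E ⊗ (A' ⊗ A₂')) :=
  LinearMap.mk₂ ℂ
    (fun r r₂ => (α_ _ _ _).hom ≫ (A ◁ r₂) ≫ (α_ _ _ _).inv ≫ (r ▷ A₂') ≫ (α_ _ _ _).hom)
    (by intros; simp) (by intros; simp) (by intros; simp) (by intros; simp)

/-- Stacking of the blue arcs along the legs `C`; the outer arc is on the right. -/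
def blueStack (B B' B₂ B₂' G C C₂ : D) :
    (C ⊗ B ⟶ B' ⊗ G) →ₗ[ℂ] (C₂ ⊗ B₂ ⟶ B₂' ⊗ C) →ₗ[ℂ]
      (C₂ ⊗ (B₂ ⊗ B) ⟶ (B₂' ⊗ B') ⊗ G) :=
  LinearMap.mk₂ ℂ
    (fun s s₂ => (α_ _ _ _).inv ≫ (s₂ ▷ B) ≫ (α_ _ _ _).hom ≫ (B₂' ◁ s) ≫ (α_ _ _ _).inv)
    (by intros; simp) (by intros; simp) (by intros; simp) (by intros; simp)

/-- Stacking of a tube diagram around another one, when the internal labels of the first are the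
external labels of the second. The two parallel red arcs are kept as one cable labelled by a
tensor product, and likewise the blue ones. -/
def diagramStack (A A' B B' A₂ A₂' B₂ B₂' : D) (o : TubeBoundary D m₂ n₂)
    (c : TubeBoundary D m₁ n₁) (i : TubeBoundary D m₀ n₀) :
    TubeDiagram A A' B B' o c →ₗ[ℂ] TubeDiagram A₂ A₂' B₂ B₂' c i →ₗ[ℂ]
      TubeDiagram (A ⊗ A₂) (A' ⊗ A₂') (B₂ ⊗ B) (B₂' ⊗ B') o i :=
  TensorProduct.map₂ (botStack A A₂ B₂ B _ _ _)
    (TensorProduct.map₂ (redStack A A' A₂ A₂' _ _ _)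
      (TensorProduct.map₂ (blueStack B B' B₂ B₂' _ _ _) (topStack A' A₂' B₂' B' _ _ _)))

/-- Inserting morphisms on the two ends of both arcs of a tube diagram. -/
def cutArcs {A A' B B' P P' Q Q' : D} (o : TubeBoundary D m₁ n₁) (i : TubeBoundary D m₀ n₀)
    (f : A ⟶ P) (f' : P ⟶ A) (g : A' ⟶ P') (g' : P' ⟶ A')
    (h : B ⟶ Q) (h' : Q ⟶ B) (k : B' ⟶ Q') (k' : Q' ⟶ B') :
    TubeDiagram A A' B B' o i →ₗ[ℂ] TubeDiagram P P' Q Q' o i :=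
  TensorProduct.map (Linear.rightComp ℂ _ ((f ▷ i.bot.obj) ⊗ₘ h))
    (TensorProduct.map
      (Linear.leftComp ℂ _ (f' ▷ i.redObj) ∘ₗ Linear.rightComp ℂ _ (o.redObj ◁ g))
      (TensorProduct.map
        (Linear.leftComp ℂ _ (i.blueObj ◁ h') ∘ₗ Linear.rightComp ℂ _ (k ▷ o.blueObj))
        (Linear.leftComp ℂ _ ((g' ▷ i.top.obj) ⊗ₘ k'))))

variable [RigidCategory D] [IsMultifusion D]

/-- The parallel move: the identity of each of the four arc segments is resolved as a sum over
simple objects. This writes a diagram with arbitrary objects on its arcs as a combination of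
diagrams with simple edges. -/
def parallelMove (A A' B B' : D) (o : TubeBoundary D m₁ n₁) (i : TubeBoundary D m₀ n₀) :
    TubeDiagram A A' B B' o i →ₗ[ℂ] TubeBlock o i :=
  let a := simpleDecomposition A
  let a' := simpleDecomposition A'
  let b := simpleDecomposition B
  let b' := simpleDecomposition B'
  ∑ j : Fin a.n, ∑ j' : Fin a'.n, ∑ l : Fin b.n, ∑ l' : Fin b'.n,
    DirectSum.lof ℂ (TubeArcs D)
        (fun k => TubeDiagram k.redBot.obj k.redTop.obj k.blueBot.obj k.blueTop.obj o i)
        ⟨a.label j, a'.label j', b.label l, b'.label l'⟩ ∘ₗ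
      cutArcs o i (a.proj j) (a.inj j) (a'.proj j') (a'.inj j')
        (b.proj l) (b.inj l) (b'.proj l') (b'.inj l')

/-- Stacking of combinations of simple-edged diagrams with matching labels in the middle. -/
def blockStack (o : TubeBoundary D m₂ n₂) (c : TubeBoundary D m₁ n₁) (i : TubeBoundary D m₀ n₀) :
    TubeBlock o c →ₗ[ℂ] TubeBlock c i →ₗ[ℂ] TubeBlock o i :=
  DirectSum.toModule ℂ _ _ fun k =>
    (DirectSum.toModule ℂ _ _ fun k₂ =>
      ((diagramStack k.redBot.obj k.redTop.obj k.blueBot.obj k.blueTop.obj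
        k₂.redBot.obj k₂.redTop.obj k₂.blueBot.obj k₂.blueTop.obj o c i).compr₂
          (parallelMove _ _ _ _ o i)).flip).flip

/-- Stacking `X ∈ T^{m₁,m₂;n₁,n₂}` around `Y ∈ T^{m₀,m₁;n₀,n₁}`. Diagrams compose only if all the
labels on the common circle agree. -/
def tubeStack :
    TubeSpace D m₁ m₂ n₁ n₂ →ₗ[ℂ] TubeSpace D m₀ m₁ n₀ n₁ →ₗ[ℂ] TubeSpace D m₀ m₂ n₀ n₂ :=
  LinearMap.mk₂ ℂ (fun X Y o i => ∑ c, blockStack o c i (X o c) (Y c i))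
    (by intros; ext1; ext1; simp [Finset.sum_add_distrib])
    (by intros; ext1; ext1; simp [Finset.smul_sum])
    (by intros; ext1; ext1; simp [Finset.sum_add_distrib])
    (by intros; ext1; ext1; simp [Finset.smul_sum])

/-- The diagram with both arcs labelled by the tensor unit and all the other edges running straight
from the inside to the outside. -/
def straightDiagram {m n : ℕ} (o : TubeBoundary D m n) :
    TubeDiagram (𝟙_ D) (𝟙_ D) (𝟙_ D) (𝟙_ D) o o :=
  ((λ_ o.bot.obj).inv ≫ (ρ_ _).inv) ⊗ₜ
    (((λ_ o.redObj).hom ≫ (ρ_ o.redObj).inv) ⊗ₜ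
      (((ρ_ o.blueObj).hom ≫ (λ_ o.blueObj).inv) ⊗ₜ
        ((ρ_ _).hom ≫ (λ_ o.top.obj).hom)))

variable (D) in
/-- The sum of the straight diagrams over all boundary labels. -/
def tubeOne (m n : ℕ) : TubeSpace D m m n n :=
  fun o => Pi.single o (parallelMove _ _ _ _ o o (straightDiagram o))

/-! ### The bulk tube algebra -/

/-- Tubes without legs whose red arc is a single edge `A` and whose blue arc is a single edge
`B`; `o` and `i` are the top and bottom labels outside and inside. -/
abbrev BulkDiagram (A B : D) (o i : Irr D × Irr D) : Type v :=
  (o.2.obj ⟶ (A ⊗ i.2.obj) ⊗ B) ⊗[ℂ] ((A ⊗ i.1.obj) ⊗ B ⟶ o.1.obj)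

/-- The span of the bulk tubes with simple edges and prescribed boundary labels. -/
abbrev BulkBlock (o i : Irr D × Irr D) : Type (max u v) :=
  DirectSum (Irr D × Irr D) fun k => BulkDiagram k.1.obj k.2.obj o i

variable (D) in
/-- The vector space underlying the bulk tube algebra. -/
abbrev BulkTube : Type (max u v) := (o : Irr D × Irr D) → (i : Irr D × Irr D) → BulkBlock o i

/-- The parallel move for bulk tubes. -/
def bulkParallelMove (A B : D) (o i : Irr D × Irr D) : BulkDiagram A B o i →ₗ[ℂ] BulkBlock o i :=
  let a := simpleDecomposition A
  let b := simpleDecomposition B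
  ∑ j : Fin a.n, ∑ l : Fin b.n,
    DirectSum.lof ℂ (Irr D × Irr D) (fun k => BulkDiagram k.1.obj k.2.obj o i)
        ⟨a.label j, b.label l⟩ ∘ₗ
      TensorProduct.map (Linear.rightComp ℂ _ ((a.proj j ▷ i.2.obj) ⊗ₘ b.proj l))
        (Linear.leftComp ℂ _ ((a.inj j ▷ i.1.obj) ⊗ₘ b.inj l))

/-- Stacking of bulk tubes with matching labels in the middle. -/
def bulkBlockStack (o c i : Irr D × Irr D) :
    BulkBlock o c →ₗ[ℂ] BulkBlock c i →ₗ[ℂ] BulkBlock o i :=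
  DirectSum.toModule ℂ _ _ fun k =>
    (DirectSum.toModule ℂ _ _ fun k₂ =>
      ((TensorProduct.map₂ (botStack k.1.obj k₂.1.obj k₂.2.obj k.2.obj _ _ _)
        (topStack k.1.obj k₂.1.obj k₂.2.obj k.2.obj _ _ _)).compr₂
          (bulkParallelMove _ _ o i)).flip).flip

/-- The multiplication of the bulk tube algebra. -/
def bulkMul (X Y : BulkTube D) : BulkTube D :=
  fun o i => ∑ c, bulkBlockStack o c i (X o c) (Y c i)

variable (D) in
/-- The unit of the bulk tube algebra. -/
def bulkOne : BulkTube D :=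
  fun o => Pi.single o (bulkParallelMove (𝟙_ D) (𝟙_ D) o o
    (((λ_ o.2.obj).inv ≫ (ρ_ _).inv) ⊗ₜ ((ρ_ _).hom ≫ (λ_ o.1.obj).hom)))

/-- A bulk tube regarded as an element of `T^{0,0;0,0}`: the red edge `A` is a red arc without
legs running from `A` to `A`, and likewise for the blue edge. -/
def bulkToTube : BulkTube D →ₗ[ℂ] TubeSpace D 0 0 0 0 :=
  LinearMap.pi fun o => LinearMap.pi fun i =>
    (DirectSum.toModule ℂ (Irr D × Irr D) (TubeBlock o i) fun k =>
      DirectSum.lof ℂ (TubeArcs D)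
          (fun k => TubeDiagram k.redBot.obj k.redTop.obj k.blueBot.obj k.blueTop.obj o i)
          ⟨k.1, k.1, k.2, k.2⟩ ∘ₗ
        TensorProduct.map LinearMap.id
          (TensorProduct.mk ℂ (k.1.obj ⊗ i.redObj ⟶ o.redObj ⊗ k.1.obj) _
              ((ρ_ k.1.obj).hom ≫ (λ_ k.1.obj).inv) ∘ₗ
            TensorProduct.mk ℂ (i.blueObj ⊗ k.2.obj ⟶ k.2.obj ⊗ o.blueObj) _
              ((λ_ k.2.obj).hom ≫ (ρ_ k.2.obj).inv))) ∘ₗ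
    LinearMap.proj (i.top, i.bot) ∘ₗ LinearMap.proj (o.top, o.bot)

end

/-! ### Algebras and bimodules -/

section

variable (D : Type u) [Category.{v} D] [Abelian D] [Linear ℂ D] [MonoidalCategory D]
  [MonoidalPreadditive D] [MonoidalLinear ℂ D] [RigidCategory D] [IsMultifusion D]

/-- Stacking of tubes is associative and has the tubes `tubeOne` as units. -/
structure TubeLaws : Prop where
  assoc : ∀ {m₀ m₁ m₂ m₃ n₀ n₁ n₂ n₃ : ℕ} (X : TubeSpace D m₂ m₃ n₂ n₃)
    (Y : TubeSpace D m₁ m₂ n₁ n₂) (Z : TubeSpace D m₀ m₁ n₀ n₁),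
    tubeStack (tubeStack X Y) Z = tubeStack X (tubeStack Y Z)
  one_stack : ∀ {m₀ m₁ n₀ n₁ : ℕ} (X : TubeSpace D m₀ m₁ n₀ n₁),
    tubeStack (tubeOne D m₁ n₁) X = X
  stack_one : ∀ {m₀ m₁ n₀ n₁ : ℕ} (X : TubeSpace D m₀ m₁ n₀ n₁),
    tubeStack X (tubeOne D m₀ n₀) = X

variable {D}

/-- `T^{m,m;n,n}` as an algebra under stacking. -/
def TubeAlg (_ : TubeLaws D) (m n : ℕ) : Type (max u v) := TubeSpace D m m n n

/-- `T^{m,s;n,t}` as a left module over `T^{s,s;t,t}` and a right module over `T^{m,m;n,n}`, by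
stacking on the outside and on the inside. -/
def TubeBimod (_ : TubeLaws D) (m s n t : ℕ) : Type (max u v) := TubeSpace D m s n t

variable (h : TubeLaws D) (m s n t : ℕ)

instance : AddCommGroup (TubeAlg h m n) := inferInstanceAs (AddCommGroup (TubeSpace D m m n n))
instance : Module ℂ (TubeAlg h m n) := inferInstanceAs (Module ℂ (TubeSpace D m m n n))
instance : AddCommGroup (TubeBimod h m s n t) :=
  inferInstanceAs (AddCommGroup (TubeSpace D m s n t))
instance : Module ℂ (TubeBimod h m s n t) := inferInstanceAs (Module ℂ (TubeSpace D m s n t))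

/-- Stacking as an operation on the bimodules and algebras. -/
abbrev stack {m s p n t q : ℕ} (X : TubeSpace D s p t q) (Y : TubeSpace D m s n t) :
    TubeSpace D m p n q := tubeStack X Y

instance : Ring (TubeAlg h m n) :=
  { (inferInstance : AddCommGroup (TubeAlg h m n)) with
    mul := fun X Y => stack X Y
    one := tubeOne D m n
    mul_assoc := fun X Y Z => h.assoc X Y Z
    one_mul := fun X => h.one_stack X
    mul_one := fun X => h.stack_one X
    left_distrib := fun X Y Z => map_add (tubeStack (D := D) X) Y Z
    right_distrib := fun X Y Z => LinearMap.map_add₂ (tubeStack (D := D)) X Y Z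
    zero_mul := fun X => LinearMap.map_zero₂ (tubeStack (D := D)) X
    mul_zero := fun X => map_zero (tubeStack (D := D) X) }

instance : Algebra ℂ (TubeAlg h m n) :=
  Algebra.ofModule (fun c X Y => LinearMap.map_smul₂ (tubeStack (D := D)) c X Y)
    (fun c X Y => map_smul (tubeStack (D := D) X) c Y)

instance : Module (TubeAlg h s t) (TubeBimod h m s n t) where
  smul a X := stack a X
  one_smul X := h.one_stack X
  mul_smul a b X := h.assoc a b X
  smul_zero a := map_zero (tubeStack (D := D) a)
  smul_add a X Y := map_add (tubeStack (D := D) a) X Y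
  add_smul a b X := LinearMap.map_add₂ (tubeStack (D := D)) a b X
  zero_smul X := LinearMap.map_zero₂ (tubeStack (D := D)) X

instance : Module (TubeAlg h m n)ᵐᵒᵖ (TubeBimod h m s n t) where
  smul a X := stack X a.unop
  one_smul X := h.stack_one X
  mul_smul a b X := (h.assoc X b.unop a.unop).symm
  smul_zero a := LinearMap.map_zero₂ (tubeStack (D := D)) a.unop
  smul_add a X Y := LinearMap.map_add₂ (tubeStack (D := D)) X Y a.unop
  add_smul a b X := map_add (tubeStack (D := D) X) a.unop b.unop
  zero_smul X := map_zero (tubeStack (D := D) X)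

end

/-- The tensor product `M ⊗_A N` of a right module and a left module over a (not necessarily
commutative) `k`-algebra `A`. -/
abbrev BalancedTensor (k A M N : Type*) [CommRing k] [Ring A] [Algebra k A]
    [AddCommGroup M] [Module k M] [Module Aᵐᵒᵖ M] [AddCommGroup N] [Module k N] [Module A N] :
    Type _ :=
  (M ⊗[k] N) ⧸ Submodule.span k
    {z : M ⊗[k] N | ∃ (x : M) (a : A) (y : N),
      z = (MulOpposite.op a • x) ⊗ₜ[k] y - x ⊗ₜ[k] (a • y)}

/-- The class of `x ⊗ y` in `M ⊗_A N`. -/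
def BalancedTensor.tmul (k A : Type*) {M N : Type*} [CommRing k] [Ring A] [Algebra k A]
    [AddCommGroup M] [Module k M] [Module Aᵐᵒᵖ M] [AddCommGroup N] [Module k N] [Module A N]
    (x : M) (y : N) : BalancedTensor k A M N :=
  Submodule.Quotient.mk (x ⊗ₜ[k] y)

section

variable {D : Type u} [Category.{v} D] [Abelian D] [Linear ℂ D] [MonoidalCategory D]
  [MonoidalPreadditive D] [MonoidalLinear ℂ D] [RigidCategory D] [IsMultifusion D]

/-- Stacking induces an isomorphism
`T^{m,s;n,t} ⊗_{T^{m,m;n,n}} T^{s,m;t,n} ≅ T^{s,s;t,t}` of `T^{s,s;t,t}`-bimodules. The two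
bimodule structures on the left are determined by their values on the classes of `X ⊗ Y`. -/
def StackingIsBimoduleIso (h : TubeLaws D) (m s n t : ℕ) : Prop :=
  ∃ e : BalancedTensor ℂ (TubeAlg h m n) (TubeBimod h m s n t) (TubeBimod h s m t n) ≃ₗ[ℂ]
      TubeAlg h s t,
    (∀ (X : TubeBimod h m s n t) (Y : TubeBimod h s m t n),
      e (.tmul ℂ (TubeAlg h m n) X Y) = stack X Y) ∧
    (∀ (a : TubeAlg h s t) (X : TubeBimod h m s n t) (Y : TubeBimod h s m t n),
      e (.tmul ℂ (TubeAlg h m n) (a • X) Y) = a * e (.tmul ℂ (TubeAlg h m n) X Y)) ∧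
    (∀ (a : TubeAlg h s t) (X : TubeBimod h m s n t) (Y : TubeBimod h s m t n),
      e (.tmul ℂ (TubeAlg h m n) X (MulOpposite.op a • Y)) =
        e (.tmul ℂ (TubeAlg h m n) X Y) * a)

end

end

/-! Resolving the identity of an arc segment replaces it by pairs of morphisms into and out of
simple objects. By Schur's lemma over `ℂ`, a morphism between chosen simple objects is zero or a
scalar, so in any expression bilinear in such pairs morphisms slide through the resolution
(`resolution_slide`). Hence a tube may carry arbitrary objects on its arcs (`tube`), independently
of all decompositions, and a morphism on an arc segment may be attached to the vertex at either end
of it (`tube_congr`). Stacking such tubes merely composes vertices and tensors arcs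
(`blockStack_tube`). Associativity and unitality of stacking then reduce to coherence: the two sides
are tubes whose arcs differ by associators or unitors.

By associativity, stacking is a Morita context. A context whose two pairings both have `1` in their
image yields isomorphisms from the balanced tensor products and mutually inverse Hom functors. It
remains to write a straight tube as a sum of stackings through any numbers of legs
(`exists_straightTube_eq_sum`). Rigidity does this. The inner tube takes its internal legs `C` up
along its red arc to the upper vertical line; the outer tube emits `C` again from a coevaluation,
leaving a dual strand on its arc. On the upper line the strand `C` meets its dual and evaluation
closes a snake, and likewise on the blue side. Between the two tubes the arcs exchange nothing but
the unit object, whose identity factors through products of any number of simple legs.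

For tubes without legs, the vertex on an arc is, up to unitors, a morphism from the lower end of the
arc to the upper one. Absorbing it into the upper vertical line inverts the map from the bulk tube
algebra. -/

/-! ### Schur's lemma and sliding through resolutions of the identity. -/

section Schur

variable {D : Type u} [Category.{v} D] [Abelian D]

instance Irr.simple_obj (a : Irr D) : Simple a.obj :=
  (Quotient.out (s := simpleSetoid D) a).2

theorem Irr.eq_of_iso {a b : Irr D} (e : a.obj ≅ b.obj) : a = b := by
  rw [← Quotient.out_eq (s := simpleSetoid D) a, ← Quotient.out_eq (s := simpleSetoid D) b]
  exact Quotient.sound (s := simpleSetoid D) ⟨e⟩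

theorem Irr.hom_eq_zero_of_ne {a b : Irr D} (h : a ≠ b) (f : a.obj ⟶ b.obj) : f = 0 := by
  by_contra hf
  have := isIso_of_hom_simple hf
  exact h (Irr.eq_of_iso (asIso f))

/-- The trivial decomposition of a simple object. -/
noncomputable def SimpleDecomposition.ofIrr (a : Irr D) : SimpleDecomposition a.obj where
  n := 1
  label _ := a
  inj _ := 𝟙 _
  proj _ := 𝟙 _
  inj_proj_self := by simp
  inj_proj_ne i j h := absurd (Subsingleton.elim i j) h
  total := by simp

instance (a : Irr D) : Unique (Fin (SimpleDecomposition.ofIrr a).n) :=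
  inferInstanceAs (Unique (Fin 1))

variable [Linear ℂ D] [MonoidalCategory D] [MonoidalPreadditive D] [MonoidalLinear ℂ D]
  [RigidCategory D] [IsMultifusion D]

theorem Irr.endomorphism_eq_smul_id (a : Irr D) (f : a.obj ⟶ a.obj) :
    ∃ c : ℂ, f = c • 𝟙 a.obj := by
  have := IsMultifusion.finiteDimensional a.obj a.obj
  obtain ⟨c, hc⟩ := endomorphism_simple_eq_smul_id ℂ f
  exact ⟨c, hc.symm⟩

/-- Morphisms between simple objects can be moved across any family of bilinear maps. -/
theorem bilin_balanced {A P : D} {W : Type*} [AddCommGroup W] [Module ℂ W]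
    (φ : ∀ x : Irr D, (A ⟶ x.obj) →ₗ[ℂ] (x.obj ⟶ P) →ₗ[ℂ] W) {x y : Irr D}
    (f : x.obj ⟶ y.obj) (u : A ⟶ x.obj) (w : y.obj ⟶ P) :
    φ y (u ≫ f) w = φ x u (f ≫ w) := by
  by_cases h : x = y
  · subst h
    obtain ⟨c, rfl⟩ := x.endomorphism_eq_smul_id f
    simp
  · simp [Irr.hom_eq_zero_of_ne h f]

/-- A morphism can be moved across a resolution of the identity into simple objects. -/
theorem resolution_slide {A P : D} {W : Type*} [AddCommGroup W] [Module ℂ W]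
    (φ : ∀ x : Irr D, (A ⟶ x.obj) →ₗ[ℂ] (x.obj ⟶ P) →ₗ[ℂ] W)
    (a : SimpleDecomposition A) (b : SimpleDecomposition P) (f : A ⟶ P) :
    ∑ j, φ (b.label j) (f ≫ b.proj j) (b.inj j) =
      ∑ k, φ (a.label k) (a.proj k) (a.inj k ≫ f) := by
  -- Both sides expand into the matrix coefficients `a.inj k ≫ f ≫ b.proj j`, which are morphisms
  -- between simple objects and therefore balanced.
  have h₁ : ∀ j, f ≫ b.proj j = ∑ k, a.proj k ≫ (a.inj k ≫ f ≫ b.proj j) := fun j => by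
    simp only [← Category.assoc, ← Preadditive.sum_comp, a.total, Category.id_comp]
  have h₂ : ∀ k, a.inj k ≫ f = ∑ j, (a.inj k ≫ f ≫ b.proj j) ≫ b.inj j := fun k => by
    simp only [Category.assoc, ← Preadditive.comp_sum, b.total, Category.comp_id]
  calc _ = ∑ j, ∑ k, φ (b.label j) (a.proj k ≫ (a.inj k ≫ f ≫ b.proj j)) (b.inj j) :=
        Finset.sum_congr rfl fun j _ => by
          conv_lhs => rw [h₁ j]
          rw [map_sum, LinearMap.sum_apply]
    _ = ∑ k, ∑ j, φ (a.label k) (a.proj k) ((a.inj k ≫ f ≫ b.proj j) ≫ b.inj j) := by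
        rw [Finset.sum_comm]
        simp only [bilin_balanced]
    _ = _ := Finset.sum_congr rfl fun k _ => by
          conv_rhs => rw [h₂ k]
          rw [map_sum]

end Schur

section Tensor

variable {D : Type u} [Category.{v} D] [Abelian D] [Linear ℂ D] [MonoidalCategory D]
  [MonoidalPreadditive D] [MonoidalLinear ℂ D] {X Y Z W : D}

theorem smul_tensorHom (c : ℂ) (f : X ⟶ Y) (g : Z ⟶ W) : ((c • f) ⊗ₘ g) = c • (f ⊗ₘ g) := by
  simp [MonoidalCategory.tensorHom_def]

theorem tensorHom_smul (c : ℂ) (f : X ⟶ Y) (g : Z ⟶ W) : (f ⊗ₘ (c • g)) = c • (f ⊗ₘ g) := by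
  simp [MonoidalCategory.tensorHom_def]

end Tensor

/-! ### Tubes with arbitrary objects on their arcs. -/

section Tube

variable {D : Type u} [Category.{v} D] [Abelian D] [Linear ℂ D] [MonoidalCategory D]

variable {m₀ m₁ n₀ n₁ : ℕ} {o : TubeBoundary D m₁ n₁} {i : TubeBoundary D m₀ n₀}

/-- The inclusion of the tube diagrams with given simple arcs. -/
noncomputable def ofSimpleArcs (x x' y y' : Irr D) :
    TubeDiagram x.obj x'.obj y.obj y'.obj o i →ₗ[ℂ] TubeBlock o i :=
  DirectSum.lof ℂ (TubeArcs D)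
    (fun k => TubeDiagram k.redBot.obj k.redTop.obj k.blueBot.obj k.blueTop.obj o i) ⟨x, x', y, y'⟩

/-- The tube diagram with given simple arcs and vertices. -/
noncomputable def simpleTube (x x' y y' : Irr D)
    (p : o.bot.obj ⟶ (x.obj ⊗ i.bot.obj) ⊗ y.obj)
    (r : x.obj ⊗ i.redObj ⟶ o.redObj ⊗ x'.obj)
    (s : i.blueObj ⊗ y.obj ⟶ y'.obj ⊗ o.blueObj)
    (q : (x'.obj ⊗ i.top.obj) ⊗ y'.obj ⟶ o.top.obj) : TubeBlock o i :=
  ofSimpleArcs x x' y y' (p ⊗ₜ (r ⊗ₜ (s ⊗ₜ q)))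

section Multilinear

variable (x x' y y' : Irr D)
  (p p₂ : o.bot.obj ⟶ (x.obj ⊗ i.bot.obj) ⊗ y.obj)
  (r r₂ : x.obj ⊗ i.redObj ⟶ o.redObj ⊗ x'.obj)
  (s s₂ : i.blueObj ⊗ y.obj ⟶ y'.obj ⊗ o.blueObj)
  (q q₂ : (x'.obj ⊗ i.top.obj) ⊗ y'.obj ⟶ o.top.obj) (c : ℂ)

theorem simpleTube_add_bot :
    simpleTube x x' y y' (p + p₂) r s q =
      simpleTube x x' y y' p r s q + simpleTube x x' y y' p₂ r s q := by
  simp [simpleTube, add_tmul]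

theorem simpleTube_add_red :
    simpleTube x x' y y' p (r + r₂) s q =
      simpleTube x x' y y' p r s q + simpleTube x x' y y' p r₂ s q := by
  simp [simpleTube, add_tmul, tmul_add]

theorem simpleTube_add_blue :
    simpleTube x x' y y' p r (s + s₂) q =
      simpleTube x x' y y' p r s q + simpleTube x x' y y' p r s₂ q := by
  simp [simpleTube, add_tmul, tmul_add]

theorem simpleTube_add_top :
    simpleTube x x' y y' p r s (q + q₂) =
      simpleTube x x' y y' p r s q + simpleTube x x' y y' p r s q₂ := by
  simp [simpleTube, tmul_add]

theorem simpleTube_smul_bot : simpleTube x x' y y' (c • p) r s q =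
      c • simpleTube x x' y y' p r s q := by
  simp only [simpleTube, ← smul_tmul', map_smul]

theorem simpleTube_smul_red : simpleTube x x' y y' p (c • r) s q =
      c • simpleTube x x' y y' p r s q := by
  simp only [simpleTube, ← smul_tmul', tmul_smul, map_smul]

theorem simpleTube_smul_blue : simpleTube x x' y y' p r (c • s) q =
      c • simpleTube x x' y y' p r s q := by
  simp only [simpleTube, ← smul_tmul', tmul_smul, map_smul]

theorem simpleTube_smul_top : simpleTube x x' y y' p r s (c • q) =
      c • simpleTube x x' y y' p r s q := by
  simp only [simpleTube, tmul_smul, map_smul]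

end Multilinear

/-- The parallel move along given decompositions of the four arc segments. -/
noncomputable def resolvedTube {A A' B B' : D} (a : SimpleDecomposition A)
    (a' : SimpleDecomposition A')
    (b : SimpleDecomposition B) (b' : SimpleDecomposition B')
    (p : o.bot.obj ⟶ (A ⊗ i.bot.obj) ⊗ B) (r : A ⊗ i.redObj ⟶ o.redObj ⊗ A')
    (s : i.blueObj ⊗ B ⟶ B' ⊗ o.blueObj) (q : (A' ⊗ i.top.obj) ⊗ B' ⟶ o.top.obj) :
    TubeBlock o i :=
  ∑ j, ∑ j', ∑ l, ∑ l', simpleTube (a.label j) (a'.label j') (b.label l) (b'.label l')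
    (p ≫ ((a.proj j ▷ i.bot.obj) ⊗ₘ b.proj l))
    (a.inj j ▷ i.redObj ≫ r ≫ o.redObj ◁ a'.proj j')
    (i.blueObj ◁ b.inj l ≫ s ≫ b'.proj l' ▷ o.blueObj)
    (((a'.inj j' ▷ i.top.obj) ⊗ₘ b'.inj l') ≫ q)

variable [MonoidalPreadditive D] [MonoidalLinear ℂ D] [RigidCategory D] [IsMultifusion D]

/-- The tube diagram with arbitrary objects on its arcs, as a combination of diagrams with simple
arcs. -/
noncomputable def tube {A A' B B' : D}
    (p : o.bot.obj ⟶ (A ⊗ i.bot.obj) ⊗ B) (r : A ⊗ i.redObj ⟶ o.redObj ⊗ A')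
    (s : i.blueObj ⊗ B ⟶ B' ⊗ o.blueObj) (q : (A' ⊗ i.top.obj) ⊗ B' ⟶ o.top.obj) :
    TubeBlock o i :=
  parallelMove A A' B B' o i (p ⊗ₜ (r ⊗ₜ (s ⊗ₜ q)))

theorem tube_eq_resolvedTube {A A' B B' : D}
    (p : o.bot.obj ⟶ (A ⊗ i.bot.obj) ⊗ B) (r : A ⊗ i.redObj ⟶ o.redObj ⊗ A')
    (s : i.blueObj ⊗ B ⟶ B' ⊗ o.blueObj) (q : (A' ⊗ i.top.obj) ⊗ B' ⟶ o.top.obj) :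
    tube p r s q = resolvedTube (simpleDecomposition A) (simpleDecomposition A')
      (simpleDecomposition B) (simpleDecomposition B') p r s q := by
  simp only [tube, parallelMove, resolvedTube, simpleTube, ofSimpleArcs, cutArcs,
    LinearMap.sum_apply,
    LinearMap.comp_apply, TensorProduct.map_tmul, Linear.rightComp_apply, Linear.leftComp_apply]

section Slide

variable {A A' B B' P : D}

/-- The two sides resolve the lower red segment by unrelated decompositions, one of `P` and one of
`A`. So this gives both the sliding of morphisms and, for `f = 𝟙`, independence of the
decomposition. The other three segments are treated in the same way. -/
theorem resolvedTube_slide_redBot (a : SimpleDecomposition A) (a₂ : SimpleDecomposition P)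
    (a' : SimpleDecomposition A') (b : SimpleDecomposition B) (b' : SimpleDecomposition B')
    (f : A ⟶ P) (p : o.bot.obj ⟶ (A ⊗ i.bot.obj) ⊗ B) (r : P ⊗ i.redObj ⟶ o.redObj ⊗ A')
    (s : i.blueObj ⊗ B ⟶ B' ⊗ o.blueObj) (q : (A' ⊗ i.top.obj) ⊗ B' ⟶ o.top.obj) :
    resolvedTube a₂ a' b b' (p ≫ (f ▷ i.bot.obj) ▷ B) r s q =
      resolvedTube a a' b b' p (f ▷ i.redObj ≫ r) s q := by
  -- With the other three segments already resolved, the tube is bilinear in the projection `w` at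
  -- the lower vertex and the inclusion `w'` at the arc vertex.
  have := resolution_slide (fun x => LinearMap.mk₂ ℂ (fun (w : A ⟶ x.obj) (w' : x.obj ⟶ P) =>
    ∑ j', ∑ l, ∑ l', simpleTube (o := o) (i := i) x (a'.label j') (b.label l) (b'.label l')
      (p ≫ ((w ▷ i.bot.obj) ⊗ₘ b.proj l))
      (w' ▷ i.redObj ≫ r ≫ o.redObj ◁ a'.proj j')
      (i.blueObj ◁ b.inj l ≫ s ≫ b'.proj l' ▷ o.blueObj)
      (((a'.inj j' ▷ i.top.obj) ⊗ₘ b'.inj l') ≫ q))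
    (by intros; simp only [MonoidalPreadditive.add_tensor, MonoidalPreadditive.add_whiskerRight,
      Preadditive.comp_add, simpleTube_add_bot, Finset.sum_add_distrib])
    (by intros; simp only [smul_tensorHom, MonoidalLinear.smul_whiskerRight, Linear.comp_smul,
      simpleTube_smul_bot, Finset.smul_sum])
    (by intros; simp only [MonoidalPreadditive.add_whiskerRight, Preadditive.add_comp,
      simpleTube_add_red, Finset.sum_add_distrib])
    (by intros; simp only [MonoidalLinear.smul_whiskerRight, Linear.smul_comp, simpleTube_smul_red,
      Finset.smul_sum])) a a₂ f
  simpa [resolvedTube, MonoidalCategory.tensorHom_def] using this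

theorem resolvedTube_slide_redTop (a : SimpleDecomposition A) (a₂ : SimpleDecomposition P)
    (a' : SimpleDecomposition A') (b : SimpleDecomposition B) (b' : SimpleDecomposition B')
    (f : A' ⟶ P) (p : o.bot.obj ⟶ (A ⊗ i.bot.obj) ⊗ B) (r : A ⊗ i.redObj ⟶ o.redObj ⊗ A')
    (s : i.blueObj ⊗ B ⟶ B' ⊗ o.blueObj) (q : (P ⊗ i.top.obj) ⊗ B' ⟶ o.top.obj) :
    resolvedTube a a₂ b b' p (r ≫ o.redObj ◁ f) s q =
      resolvedTube a a' b b' p r s ((f ▷ i.top.obj) ▷ B' ≫ q) := by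
  refine Finset.sum_congr rfl fun j _ => ?_
  have := resolution_slide (fun x => LinearMap.mk₂ ℂ (fun (w : A' ⟶ x.obj) (w' : x.obj ⟶ P) =>
    ∑ l, ∑ l', simpleTube (o := o) (i := i) (a.label j) x (b.label l) (b'.label l')
      (p ≫ ((a.proj j ▷ i.bot.obj) ⊗ₘ b.proj l))
      (a.inj j ▷ i.redObj ≫ r ≫ o.redObj ◁ w)
      (i.blueObj ◁ b.inj l ≫ s ≫ b'.proj l' ▷ o.blueObj)
      (((w' ▷ i.top.obj) ⊗ₘ b'.inj l') ≫ q))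
    (by intros; simp only [MonoidalPreadditive.whiskerLeft_add, Preadditive.comp_add,
      simpleTube_add_red, Finset.sum_add_distrib])
    (by intros; simp only [MonoidalLinear.whiskerLeft_smul, Linear.comp_smul, simpleTube_smul_red,
      Finset.smul_sum])
    (by intros; simp only [MonoidalPreadditive.add_tensor, MonoidalPreadditive.add_whiskerRight,
      Preadditive.add_comp, simpleTube_add_top, Finset.sum_add_distrib])
    (by intros; simp only [smul_tensorHom, MonoidalLinear.smul_whiskerRight, Linear.smul_comp,
      simpleTube_smul_top, Finset.smul_sum])) a' a₂ f
  simpa [MonoidalCategory.tensorHom_def'] using this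

theorem resolvedTube_slide_blueBot (a : SimpleDecomposition A) (b₂ : SimpleDecomposition P)
    (a' : SimpleDecomposition A') (b : SimpleDecomposition B) (b' : SimpleDecomposition B')
    (f : B ⟶ P) (p : o.bot.obj ⟶ (A ⊗ i.bot.obj) ⊗ B) (r : A ⊗ i.redObj ⟶ o.redObj ⊗ A')
    (s : i.blueObj ⊗ P ⟶ B' ⊗ o.blueObj) (q : (A' ⊗ i.top.obj) ⊗ B' ⟶ o.top.obj) :
    resolvedTube a a' b₂ b' (p ≫ _ ◁ f) r s q =
      resolvedTube a a' b b' p r (i.blueObj ◁ f ≫ s) q := by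
  refine Finset.sum_congr rfl fun j _ => Finset.sum_congr rfl fun j' _ => ?_
  have := resolution_slide (fun x => LinearMap.mk₂ ℂ (fun (w : B ⟶ x.obj) (w' : x.obj ⟶ P) =>
    ∑ l', simpleTube (o := o) (i := i) (a.label j) (a'.label j') x (b'.label l')
      (p ≫ ((a.proj j ▷ i.bot.obj) ⊗ₘ w))
      (a.inj j ▷ i.redObj ≫ r ≫ o.redObj ◁ a'.proj j')
      (i.blueObj ◁ w' ≫ s ≫ b'.proj l' ▷ o.blueObj)
      (((a'.inj j' ▷ i.top.obj) ⊗ₘ b'.inj l') ≫ q))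
    (by intros; simp only [MonoidalPreadditive.tensor_add, Preadditive.comp_add,
      simpleTube_add_bot, Finset.sum_add_distrib])
    (by intros; simp only [tensorHom_smul, Linear.comp_smul, simpleTube_smul_bot, Finset.smul_sum])
    (by intros; simp only [MonoidalPreadditive.whiskerLeft_add, Preadditive.add_comp,
      simpleTube_add_blue, Finset.sum_add_distrib])
    (by intros; simp only [MonoidalLinear.whiskerLeft_smul, Linear.smul_comp, simpleTube_smul_blue,
      Finset.smul_sum])) b b₂ f
  simpa [MonoidalCategory.tensorHom_def'] using this

theorem resolvedTube_slide_blueTop (a : SimpleDecomposition A) (b₂ : SimpleDecomposition P)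
    (a' : SimpleDecomposition A') (b : SimpleDecomposition B) (b' : SimpleDecomposition B')
    (f : B' ⟶ P) (p : o.bot.obj ⟶ (A ⊗ i.bot.obj) ⊗ B) (r : A ⊗ i.redObj ⟶ o.redObj ⊗ A')
    (s : i.blueObj ⊗ B ⟶ B' ⊗ o.blueObj) (q : (A' ⊗ i.top.obj) ⊗ P ⟶ o.top.obj) :
    resolvedTube a a' b b₂ p r (s ≫ f ▷ o.blueObj) q =
      resolvedTube a a' b b' p r s (_ ◁ f ≫ q) := by
  refine Finset.sum_congr rfl fun j _ => Finset.sum_congr rfl fun j' _ =>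
    Finset.sum_congr rfl fun l _ => ?_
  have := resolution_slide (fun x => LinearMap.mk₂ ℂ (fun (w : B' ⟶ x.obj) (w' : x.obj ⟶ P) =>
    simpleTube (o := o) (i := i) (a.label j) (a'.label j') (b.label l) x
      (p ≫ ((a.proj j ▷ i.bot.obj) ⊗ₘ b.proj l))
      (a.inj j ▷ i.redObj ≫ r ≫ o.redObj ◁ a'.proj j')
      (i.blueObj ◁ b.inj l ≫ s ≫ w ▷ o.blueObj)
      (((a'.inj j' ▷ i.top.obj) ⊗ₘ w') ≫ q))
    (by intros; simp only [MonoidalPreadditive.add_whiskerRight, Preadditive.comp_add,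
      simpleTube_add_blue])
    (by intros; simp only [MonoidalLinear.smul_whiskerRight, Linear.comp_smul,
      simpleTube_smul_blue])
    (by intros; simp only [MonoidalPreadditive.tensor_add, Preadditive.add_comp,
      simpleTube_add_top])
    (by intros; simp only [tensorHom_smul, Linear.smul_comp, simpleTube_smul_top])) b' b₂ f
  simpa [MonoidalCategory.tensorHom_def] using this

/-- Sliding an identity along each segment exchanges the given decompositions for the chosen ones,
one at a time. -/
theorem resolvedTube_eq_tube (a : SimpleDecomposition A)
    (a' : SimpleDecomposition A') (b : SimpleDecomposition B) (b' : SimpleDecomposition B')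
    (p : o.bot.obj ⟶ (A ⊗ i.bot.obj) ⊗ B) (r : A ⊗ i.redObj ⟶ o.redObj ⊗ A')
    (s : i.blueObj ⊗ B ⟶ B' ⊗ o.blueObj) (q : (A' ⊗ i.top.obj) ⊗ B' ⟶ o.top.obj) :
    resolvedTube a a' b b' p r s q = tube p r s q := by
  rw [tube_eq_resolvedTube]
  have h₁ := resolvedTube_slide_redBot a (simpleDecomposition A) a' b b' (𝟙 A) p r s q
  have h₂ := resolvedTube_slide_redTop (simpleDecomposition A) (simpleDecomposition A') a' b b'
    (𝟙 A') p r s q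
  have h₃ := resolvedTube_slide_blueBot (simpleDecomposition A) (simpleDecomposition B)
    (simpleDecomposition A') b b' (𝟙 B) p r s q
  have h₄ := resolvedTube_slide_blueTop (simpleDecomposition A) (simpleDecomposition B')
    (simpleDecomposition A') (simpleDecomposition B) b' (𝟙 B') p r s q
  simp only [id_whiskerRight, whiskerLeft_id, Category.comp_id, Category.id_comp] at h₁ h₂ h₃ h₄
  rw [h₄, h₃, h₂, h₁]

/-- A simple arc can be resolved by its one-term decomposition, so the parallel move does nothing to
it. -/
theorem simpleTube_eq_tube (x x' y y' : Irr D)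
    (p : o.bot.obj ⟶ (x.obj ⊗ i.bot.obj) ⊗ y.obj)
    (r : x.obj ⊗ i.redObj ⟶ o.redObj ⊗ x'.obj)
    (s : i.blueObj ⊗ y.obj ⟶ y'.obj ⊗ o.blueObj)
    (q : (x'.obj ⊗ i.top.obj) ⊗ y'.obj ⟶ o.top.obj) :
    simpleTube x x' y y' p r s q = tube p r s q := by
  rw [← resolvedTube_eq_tube (.ofIrr _) (.ofIrr _) (.ofIrr _) (.ofIrr _)]
  simp only [resolvedTube, Fintype.sum_unique]
  simp [SimpleDecomposition.ofIrr]

theorem tube_slide_redBot (f : A ⟶ P) (p : o.bot.obj ⟶ (A ⊗ i.bot.obj) ⊗ B)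
    (r : P ⊗ i.redObj ⟶ o.redObj ⊗ A')
    (s : i.blueObj ⊗ B ⟶ B' ⊗ o.blueObj) (q : (A' ⊗ i.top.obj) ⊗ B' ⟶ o.top.obj) :
    tube (p ≫ (f ▷ i.bot.obj) ▷ B) r s q = tube p (f ▷ i.redObj ≫ r) s q := by
  simp only [tube_eq_resolvedTube, resolvedTube_slide_redBot (simpleDecomposition A)]

theorem tube_slide_redTop (f : A' ⟶ P) (p : o.bot.obj ⟶ (A ⊗ i.bot.obj) ⊗ B)
    (r : A ⊗ i.redObj ⟶ o.redObj ⊗ A')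
    (s : i.blueObj ⊗ B ⟶ B' ⊗ o.blueObj) (q : (P ⊗ i.top.obj) ⊗ B' ⟶ o.top.obj) :
    tube p (r ≫ o.redObj ◁ f) s q = tube p r s ((f ▷ i.top.obj) ▷ B' ≫ q) := by
  simp only [tube_eq_resolvedTube,
    resolvedTube_slide_redTop _ (simpleDecomposition P) (simpleDecomposition A')]

theorem tube_slide_blueBot (f : B ⟶ P) (p : o.bot.obj ⟶ (A ⊗ i.bot.obj) ⊗ B)
    (r : A ⊗ i.redObj ⟶ o.redObj ⊗ A')
    (s : i.blueObj ⊗ P ⟶ B' ⊗ o.blueObj) (q : (A' ⊗ i.top.obj) ⊗ B' ⟶ o.top.obj) :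
    tube (p ≫ (A ⊗ i.bot.obj) ◁ f) r s q = tube p r (i.blueObj ◁ f ≫ s) q := by
  simp only [tube_eq_resolvedTube,
    resolvedTube_slide_blueBot _ (simpleDecomposition P) _ (simpleDecomposition B)]

theorem tube_slide_blueTop (f : B' ⟶ P) (p : o.bot.obj ⟶ (A ⊗ i.bot.obj) ⊗ B)
    (r : A ⊗ i.redObj ⟶ o.redObj ⊗ A')
    (s : i.blueObj ⊗ B ⟶ B' ⊗ o.blueObj) (q : (A' ⊗ i.top.obj) ⊗ P ⟶ o.top.obj) :
    tube p r (s ≫ f ▷ o.blueObj) q = tube p r s ((A' ⊗ i.top.obj) ◁ f ≫ q) := by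
  simp only [tube_eq_resolvedTube,
    resolvedTube_slide_blueTop _ (simpleDecomposition P) _ _ (simpleDecomposition B')]

end Slide

theorem tube_sum_red {A A' B B' : D} {ι : Type*} (t : Finset ι)
    (p : o.bot.obj ⟶ (A ⊗ i.bot.obj) ⊗ B) (r : ι → (A ⊗ i.redObj ⟶ o.redObj ⊗ A'))
    (s : i.blueObj ⊗ B ⟶ B' ⊗ o.blueObj) (q : (A' ⊗ i.top.obj) ⊗ B' ⟶ o.top.obj) :
    tube p (∑ x ∈ t, r x) s q = ∑ x ∈ t, tube p (r x) s q := by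
  simp only [tube, sum_tmul, tmul_sum, map_sum]

theorem tube_sum_blue {A A' B B' : D} {ι : Type*} (t : Finset ι)
    (p : o.bot.obj ⟶ (A ⊗ i.bot.obj) ⊗ B) (r : A ⊗ i.redObj ⟶ o.redObj ⊗ A')
    (s : ι → (i.blueObj ⊗ B ⟶ B' ⊗ o.blueObj)) (q : (A' ⊗ i.top.obj) ⊗ B' ⟶ o.top.obj) :
    tube p r (∑ x ∈ t, s x) q = ∑ x ∈ t, tube p r (s x) q := by
  simp only [tube, sum_tmul, tmul_sum, map_sum]

theorem tube_sum_top {A A' B B' : D} {ι : Type*} (t : Finset ι)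
    (p : o.bot.obj ⟶ (A ⊗ i.bot.obj) ⊗ B) (r : A ⊗ i.redObj ⟶ o.redObj ⊗ A')
    (s : i.blueObj ⊗ B ⟶ B' ⊗ o.blueObj) (q : ι → ((A' ⊗ i.top.obj) ⊗ B' ⟶ o.top.obj)) :
    tube p r s (∑ x ∈ t, q x) = ∑ x ∈ t, tube p r s (q x) := by
  simp only [tube, tmul_sum, map_sum]

/-- Combinations of tubes are exhausted by tubes with simple arcs. -/
theorem TubeBlock.induction {motive : TubeBlock o i → Prop} (zero : motive 0)
    (add : ∀ X Y, motive X → motive Y → motive (X + Y))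
    (simple : ∀ (x x' y y' : Irr D) (p : o.bot.obj ⟶ (x.obj ⊗ i.bot.obj) ⊗ y.obj)
      (r : x.obj ⊗ i.redObj ⟶ o.redObj ⊗ x'.obj)
      (s : i.blueObj ⊗ y.obj ⟶ y'.obj ⊗ o.blueObj)
      (q : (x'.obj ⊗ i.top.obj) ⊗ y'.obj ⟶ o.top.obj),
      motive (simpleTube x x' y y' p r s q)) (X : TubeBlock o i) : motive X := by
  refine DirectSum.induction_on X zero (fun k t => ?_) add
  change motive (ofSimpleArcs k.redBot k.redTop k.blueBot k.blueTop t)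
  refine TensorProduct.induction_on t (by rwa [map_zero]) (fun p t => ?_)
    (fun _ _ h₁ h₂ => by rw [map_add]; exact add _ _ h₁ h₂)
  refine TensorProduct.induction_on t (by rwa [tmul_zero, map_zero]) (fun r t => ?_)
    (fun _ _ h₁ h₂ => by rw [tmul_add, map_add]; exact add _ _ h₁ h₂)
  refine TensorProduct.induction_on t (by rwa [tmul_zero, tmul_zero, map_zero])
    (fun s q => simple _ _ _ _ p r s q)
    (fun _ _ h₁ h₂ => by rw [tmul_add, tmul_add, map_add]; exact add _ _ h₁ h₂)

end Tube

/-! ### Stacking of tubes: compatibility with resolutions, associativity and units. -/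

section Stacking

variable {D : Type u} [Category.{v} D] [Abelian D] [Linear ℂ D] [MonoidalCategory D]
  [MonoidalPreadditive D] [MonoidalLinear ℂ D]

theorem nestIso_inv_naturality {A A₁ A₂ A₃ V V' B₂ B₃ B B₁ : D} (f : A ⟶ A₁) (f₂ : A₂ ⟶ A₃)
    (w : V ⟶ V') (h₂ : B₂ ⟶ B₃) (h : B ⟶ B₁) :
    (nestIso A A₂ V B₂ B).inv ≫ (((f ⊗ₘ f₂) ⊗ₘ w) ⊗ₘ (h₂ ⊗ₘ h)) =
      ((f ⊗ₘ ((f₂ ⊗ₘ w) ⊗ₘ h₂)) ⊗ₘ h) ≫ (nestIso A₁ A₃ V' B₃ B₁).inv := by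
  simp [nestIso, MonoidalCategory.tensorHom_def]
  monoidal

theorem nestIso_hom_naturality {A A₁ A₂ A₃ V V' B₂ B₃ B B₁ : D} (f : A ⟶ A₁) (f₂ : A₂ ⟶ A₃)
    (w : V ⟶ V') (h₂ : B₂ ⟶ B₃) (h : B ⟶ B₁) :
    (((f ⊗ₘ f₂) ⊗ₘ w) ⊗ₘ (h₂ ⊗ₘ h)) ≫ (nestIso A₁ A₃ V' B₃ B₁).hom =
      (nestIso A A₂ V B₂ B).hom ≫ ((f ⊗ₘ ((f₂ ⊗ₘ w) ⊗ₘ h₂)) ⊗ₘ h) := by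
  rw [← Iso.inv_comp_eq, ← Category.assoc, nestIso_inv_naturality, Category.assoc,
    Iso.inv_hom_id, Category.comp_id]

theorem botStack_apply (A A₂ B₂ B y v' v : D) (p : y ⟶ (A ⊗ v') ⊗ B)
    (p₂ : v' ⟶ (A₂ ⊗ v) ⊗ B₂) :
    botStack A A₂ B₂ B y v' v p p₂ = p ≫ ((A ◁ p₂) ▷ B) ≫ (nestIso A A₂ v B₂ B).inv :=
  rfl

theorem topStack_apply (A A₂ B₂ B x u' u : D) (q : (A ⊗ u') ⊗ B ⟶ x)
    (q₂ : (A₂ ⊗ u) ⊗ B₂ ⟶ u') :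
    topStack A A₂ B₂ B x u' u q q₂ = (nestIso A A₂ u B₂ B).hom ≫ ((A ◁ q₂) ▷ B) ≫ q :=
  rfl

theorem redStack_apply (A A' A₂ A₂' E C C₂ : D) (r : A ⊗ C ⟶ E ⊗ A')
    (r₂ : A₂ ⊗ C₂ ⟶ C ⊗ A₂') :
    redStack A A' A₂ A₂' E C C₂ r r₂ =
      (α_ _ _ _).hom ≫ (A ◁ r₂) ≫ (α_ _ _ _).inv ≫ (r ▷ A₂') ≫ (α_ _ _ _).hom :=
  rfl

theorem blueStack_apply (B B' B₂ B₂' G C C₂ : D) (s : C ⊗ B ⟶ B' ⊗ G)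
    (s₂ : C₂ ⊗ B₂ ⟶ B₂' ⊗ C) :
    blueStack B B' B₂ B₂' G C C₂ s s₂ =
      (α_ _ _ _).inv ≫ (s₂ ▷ B) ≫ (α_ _ _ _).hom ≫ (B₂' ◁ s) ≫ (α_ _ _ _).inv :=
  rfl

/-- This and the following `_outer` and `_inner` lemmas express naturality of stacking in the arcs:
cutting the arcs of one factor amounts to cutting the corresponding tensor factor of the stacked
arcs. -/
theorem botStack_outer {A A₁ A₂ B₂ B B₁ y v' v : D} (p : y ⟶ (A ⊗ v') ⊗ B)
    (p₂ : v' ⟶ (A₂ ⊗ v) ⊗ B₂) (f : A ⟶ A₁) (h : B ⟶ B₁) :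
    botStack A₁ A₂ B₂ B₁ y v' v (p ≫ ((f ▷ v') ⊗ₘ h)) p₂ =
     botStack A A₂ B₂ B y v' v p p₂ ≫ (((f ▷ A₂) ▷ v) ⊗ₘ (B₂ ◁ h)) := by
  have := nestIso_inv_naturality f (𝟙 A₂) (𝟙 v) (𝟙 B₂) h
  simp only [tensorHom_id, id_tensorHom, id_whiskerRight] at this
  simp only [botStack, LinearMap.mk₂_apply, Category.assoc, this]
  simp [← tensorHom_id, ← id_tensorHom]

theorem botStack_inner {A  A₂ A₁ B₂ B B₁ y v' v : D} (p : y ⟶ (A ⊗ v') ⊗ B)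
    (p₂ : v' ⟶ (A₂ ⊗ v) ⊗ B₂) (f : A₂ ⟶ A₁) (h : B₂ ⟶ B₁) :
    botStack A A₁ B₁ B y v' v p (p₂ ≫ ((f ▷ v) ⊗ₘ h)) =
     botStack A A₂ B₂ B y v' v p p₂ ≫ (((A ◁ f) ▷ v) ⊗ₘ (h ▷ B)) := by
  have := nestIso_inv_naturality (𝟙 A) f (𝟙 v) h (𝟙 B)
  simp only [tensorHom_id, id_tensorHom] at this
  simp only [botStack, LinearMap.mk₂_apply, Category.assoc, this]
  simp

theorem topStack_outer {A A₁ A₂ B₂ B B₁ y v' v : D} (p : (A ⊗ v') ⊗ B ⟶ y)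
    (p₂ : (A₂ ⊗ v) ⊗ B₂ ⟶ v') (f : A₁ ⟶ A) (h : B₁ ⟶ B) :
    topStack A₁ A₂ B₂ B₁ y v' v (((f ▷ v') ⊗ₘ h) ≫ p) p₂ =
     (((f ▷ A₂) ▷ v) ⊗ₘ (B₂ ◁ h)) ≫ topStack A A₂ B₂ B y v' v p p₂ := by
  have := nestIso_hom_naturality f (𝟙 A₂) (𝟙 v) (𝟙 B₂) h
  simp only [tensorHom_id, id_tensorHom, id_whiskerRight] at this
  simp only [topStack, LinearMap.mk₂_apply, reassoc_of% this]
  simp [← tensorHom_id, ← id_tensorHom]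

theorem topStack_inner {A  A₂ A₁ B₂ B B₁ y v' v : D} (p : (A ⊗ v') ⊗ B ⟶ y)
    (p₂ : (A₂ ⊗ v) ⊗ B₂ ⟶ v') (f : A₁ ⟶ A₂) (h : B₁ ⟶ B₂) :
    topStack A A₁ B₁ B y v' v p (((f ▷ v) ⊗ₘ h) ≫ p₂) =
     (((A ◁ f) ▷ v) ⊗ₘ (h ▷ B)) ≫ topStack A A₂ B₂ B y v' v p p₂  := by
  have := nestIso_hom_naturality (𝟙 A) f (𝟙 v) h (𝟙 B)
  simp only [tensorHom_id, id_tensorHom] at this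
  simp only [topStack, LinearMap.mk₂_apply, reassoc_of% this]
  simp

theorem redStack_outer {A A' A₁ A₁' A₂ A₂' E C C₂ : D} (r : A ⊗ C ⟶ E ⊗ A')
    (r₂ : A₂ ⊗ C₂ ⟶ C ⊗ A₂') (f : A₁ ⟶ A)
    (g : A' ⟶ A₁') :
    redStack A₁ A₁' A₂ A₂' E C C₂ (f ▷ C ≫ r ≫ E ◁ g) r₂ =
      (f ▷ A₂) ▷ C₂ ≫ redStack A A' A₂ A₂' E C C₂ r r₂ ≫ E ◁ (g ▷ A₂') := by
  simp only [redStack_apply, comp_whiskerRight, Category.assoc, whisker_assoc,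
    Iso.inv_hom_id, Category.comp_id]
  rw [associator_naturality_left_assoc, ← whisker_exchange_assoc,
    associator_inv_naturality_left_assoc]

theorem redStack_inner {A A' A₁ A₁' A₂ A₂' E C C₂ : D} (r : A ⊗ C ⟶ E ⊗ A')
    (r₂ : A₂ ⊗ C₂ ⟶ C ⊗ A₂') (f : A₁ ⟶ A₂)
    (g : A₂' ⟶ A₁') :
    redStack A A' A₁ A₁' E C C₂ r (f ▷ C₂ ≫ r₂ ≫ C ◁ g) =
      (A ◁ f) ▷ C₂ ≫ redStack A A' A₂ A₂' E C C₂ r r₂ ≫ E ◁ (A' ◁ g) := by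
  simp only [redStack_apply, MonoidalCategory.whiskerLeft_comp, Category.assoc, whisker_assoc,
    Iso.inv_hom_id_assoc]
  rw [associator_inv_naturality_right_assoc, whisker_exchange_assoc, associator_naturality_right]

theorem blueStack_outer {A A' A₁ A₁' A₂ A₂' E C C₂ : D} (r : C ⊗ A ⟶ A' ⊗ E)
    (r₂ : C₂ ⊗ A₂ ⟶ A₂' ⊗ C) (f : A₁ ⟶ A)
    (g : A' ⟶ A₁') :
    blueStack A₁ A₁' A₂ A₂' E C C₂ (C ◁ f ≫ r ≫ g ▷ E) r₂ =
      C₂ ◁ (A₂ ◁ f) ≫ blueStack A A' A₂ A₂' E C C₂ r r₂ ≫ (A₂' ◁ g) ▷ E := by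
  simp only [blueStack_apply, MonoidalCategory.whiskerLeft_comp, Category.assoc, whisker_assoc,
    Iso.inv_hom_id_assoc]
  rw [associator_inv_naturality_right_assoc, whisker_exchange_assoc,
    associator_naturality_right_assoc]

theorem blueStack_inner {A A' A₁ A₁' A₂ A₂' E C C₂ : D} (r : C ⊗ A ⟶ A' ⊗ E)
    (r₂ : C₂ ⊗ A₂ ⟶ A₂' ⊗ C) (f : A₁ ⟶ A₂)
    (g : A₂' ⟶ A₁') :
    blueStack A A' A₁ A₁' E C C₂ r (C₂ ◁ f ≫ r₂ ≫ g ▷ C) =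
      C₂ ◁ (f ▷ A) ≫ blueStack A A' A₂ A₂' E C C₂ r r₂ ≫ (g ▷ A') ▷ E := by
  simp only [blueStack_apply, comp_whiskerRight, Category.assoc, whisker_assoc,
    Iso.inv_hom_id_assoc]
  rw [associator_naturality_left_assoc, ← whisker_exchange_assoc, associator_inv_naturality_left]

/-- Each vertex stacks associatively only up to rebracketing the arcs. Blue arcs are tensored in the
opposite order from red ones, so they contribute the inverse associator. -/
theorem botStack_assoc {A A₂ A₃ B B₂ B₃ y v v₂ v₃ : D} (p : y ⟶ (A ⊗ v) ⊗ B)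
    (p₂ : v ⟶ (A₂ ⊗ v₂) ⊗ B₂) (p₃ : v₂ ⟶ (A₃ ⊗ v₃) ⊗ B₃) :
    botStack _ _ _ _ _ _ _ (botStack _ _ _ _ _ _ _ p p₂) p₃ ≫ ((α_ A A₂ A₃).hom ▷ v₃ ⊗ₘ (α_ B₃ B₂
      B).inv) =
    botStack _ _ _ _ _ _ _ p (botStack _ _ _ _ _ _ _ p₂ p₃) := by
  simp only [botStack, LinearMap.mk₂_apply]
  simp [nestIso, MonoidalCategory.tensorHom_def]
  monoidal

theorem topStack_assoc {A A₂ A₃ B B₂ B₃ y v v₂ v₃ : D} (p : (A ⊗ v) ⊗ B ⟶ y)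
    (p₂ : (A₂ ⊗ v₂) ⊗ B₂ ⟶ v) (p₃ : (A₃ ⊗ v₃) ⊗ B₃ ⟶ v₂) :
    topStack _ _ _ _ _ _ _ (topStack _ _ _ _ _ _ _ p p₂) p₃ = ((α_ A A₂ A₃).hom ▷ v₃ ⊗ₘ (α_ B₃ B₂
      B).inv) ≫
    topStack _ _ _ _ _ _ _ p (topStack _ _ _ _ _ _ _ p₂ p₃) := by
  simp only [topStack, LinearMap.mk₂_apply]
  simp [nestIso, MonoidalCategory.tensorHom_def]
  monoidal

theorem redStack_assoc {A A₂ A₃ A' A₂' A₃' E C C₂ C₃ : D} (r : A ⊗ C ⟶ E ⊗ A')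
    (r₂ : A₂ ⊗ C₂ ⟶ C ⊗ A₂') (r₃ : A₃ ⊗ C₃ ⟶ C₂ ⊗ A₃')  :
    redStack _ _ _ _ _ _ _ (redStack _ _ _ _ _ _ _ r r₂) r₃ ≫ E ◁ (α_ A' A₂' A₃').hom = (α_ A A₂
      A₃).hom ▷ C₃ ≫
    redStack _ _ _ _ _ _ _ r (redStack _ _ _ _ _ _ _ r₂ r₃) := by
  simp only [redStack, LinearMap.mk₂_apply]
  monoidal

theorem blueStack_assoc {A A₂ A₃ A' A₂' A₃' E C C₂ C₃ : D} (r : C ⊗ A ⟶ A' ⊗ E)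
    (r₂ : C₂ ⊗ A₂ ⟶ A₂' ⊗ C) (r₃ : C₃ ⊗ A₃ ⟶ A₃' ⊗ C₂)  :
    blueStack _ _ _ _ _ _ _ (blueStack _ _ _ _ _ _ _ r r₂) r₃ ≫ (α_ A₃' A₂' A').inv ▷ E = C₃ ◁ (α_
      A₃ A₂ A).inv ≫
    blueStack _ _ _ _ _ _ _ r (blueStack _ _ _ _ _ _ _ r₂ r₃) := by
  simp only [blueStack, LinearMap.mk₂_apply]
  monoidal

/-- An outer unit arc lies to the left of the red arc and to the right of the blue one, hence `λ_`
for red and `ρ_` for blue. For an inner unit arc, in the `_rightUnit` lemmas, the two are exchanged.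
-/
theorem botStack_leftUnit {A B y v : D} (p : y ⟶ (A ⊗ v) ⊗ B) :
    botStack (𝟙_ D) A B (𝟙_ D) y y v ((λ_ y).inv ≫ (ρ_ _).inv) p ≫
      ((λ_ A).hom ▷ v ⊗ₘ (ρ_ B).hom) = p := by
  simp only [botStack_apply]
  simp [nestIso, MonoidalCategory.tensorHom_def]

theorem topStack_leftUnit {A B y v : D} (q : (A ⊗ v) ⊗ B ⟶ y) :
    topStack (𝟙_ D) A B (𝟙_ D) y y v ((ρ_ _).hom ≫ (λ_ y).hom) q =
      ((λ_ A).hom ▷ v ⊗ₘ (ρ_ B).hom) ≫ q := by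
  simp only [topStack_apply]
  simp [nestIso, MonoidalCategory.tensorHom_def]

theorem redStack_leftUnit {A A' E C : D} (r : A ⊗ C ⟶ E ⊗ A') :
    redStack _ _ _ _ _ _ _ ((λ_ E).hom ≫ (ρ_ E).inv) r ≫ E ◁ (λ_ A').hom =
      (λ_ A).hom ▷ C ≫ r := by
  simp only [redStack_apply]
  monoidal

theorem blueStack_leftUnit {B B' G C : D} (s : C ⊗ B ⟶ B' ⊗ G) :
    blueStack _ _ _ _ _ _ _ ((ρ_ G).hom ≫ (λ_ G).inv) s ≫ (ρ_ B').hom ▷ G =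
      C ◁ (ρ_ B).hom ≫ s := by
  simp only [blueStack_apply]
  monoidal

theorem botStack_rightUnit {A B y v : D} (p : y ⟶ (A ⊗ v) ⊗ B) :
    botStack A (𝟙_ D) (𝟙_ D) B y v v p ((λ_ v).inv ≫ (ρ_ _).inv) ≫
      ((ρ_ A).hom ▷ v ⊗ₘ (λ_ B).hom) = p := by
  simp only [botStack_apply]
  simp only [nestIso, Iso.trans_inv, Iso.symm_inv, whiskerRightIso_inv]
  monoidal

theorem topStack_rightUnit {A B y v : D} (q : (A ⊗ v) ⊗ B ⟶ y) :
    topStack A (𝟙_ D) (𝟙_ D) B y v v q ((ρ_ _).hom ≫ (λ_ v).hom) =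
      ((ρ_ A).hom ▷ v ⊗ₘ (λ_ B).hom) ≫ q := by
  simp only [topStack_apply]
  simp only [nestIso, Iso.trans_hom, Iso.symm_hom, whiskerRightIso_hom]
  monoidal

theorem redStack_rightUnit {A A' E C : D} (r : A ⊗ C ⟶ E ⊗ A') :
    redStack _ _ _ _ _ _ _ r ((λ_ C).hom ≫ (ρ_ C).inv) ≫ E ◁ (ρ_ A').hom =
      (ρ_ A).hom ▷ C ≫ r := by
  simp only [redStack_apply]
  monoidal

theorem blueStack_rightUnit {B B' G C : D} (s : C ⊗ B ⟶ B' ⊗ G) :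
    blueStack _ _ _ _ _ _ _ s ((ρ_ C).hom ≫ (λ_ C).inv) ≫ (λ_ B').hom ▷ G =
      C ◁ (λ_ B).hom ≫ s := by
  simp only [blueStack_apply]
  monoidal

variable {m₀ m₁ m₂ n₀ n₁ n₂ : ℕ} {o : TubeBoundary D m₂ n₂} {c : TubeBoundary D m₁ n₁}
  {i : TubeBoundary D m₀ n₀} [RigidCategory D] [IsMultifusion D]

/-- Resolutions of the identity of the four arc segments do not change a tube. -/
theorem tube_resolution {A A' B B' : D} {ι ι' κ κ' : Type*} [Fintype ι] [Fintype ι'] [Fintype κ]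
    [Fintype κ'] {X : ι → D} {X' : ι' → D} {Y : κ → D} {Y' : κ' → D}
    {f : ∀ j, A ⟶ X j} {g : ∀ j, X j ⟶ A} (hA : ∑ j, f j ≫ g j = 𝟙 A)
    {f' : ∀ j, A' ⟶ X' j} {g' : ∀ j, X' j ⟶ A'} (hA' : ∑ j, f' j ≫ g' j = 𝟙 A')
    {h : ∀ j, B ⟶ Y j} {k : ∀ j, Y j ⟶ B} (hB : ∑ j, h j ≫ k j = 𝟙 B)
    {h' : ∀ j, B' ⟶ Y' j} {k' : ∀ j, Y' j ⟶ B'} (hB' : ∑ j, h' j ≫ k' j = 𝟙 B')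
    (p : o.bot.obj ⟶ (A ⊗ i.bot.obj) ⊗ B) (r : A ⊗ i.redObj ⟶ o.redObj ⊗ A')
    (s : i.blueObj ⊗ B ⟶ B' ⊗ o.blueObj) (q : (A' ⊗ i.top.obj) ⊗ B' ⟶ o.top.obj) :
    ∑ j, ∑ j', ∑ l, ∑ l',
      tube (p ≫ ((f j ▷ i.bot.obj) ⊗ₘ h l))
        (g j ▷ i.redObj ≫ r ≫ o.redObj ◁ f' j')
        (i.blueObj ◁ k l ≫ s ≫ h' l' ▷ o.blueObj)
        (((g' j' ▷ i.top.obj) ⊗ₘ k' l') ≫ q) = tube p r s q := by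
  have key : ∀ j j' l l', tube (p ≫ ((f j ▷ i.bot.obj) ⊗ₘ h l))
        (g j ▷ i.redObj ≫ r ≫ o.redObj ◁ f' j')
        (i.blueObj ◁ k l ≫ s ≫ h' l' ▷ o.blueObj)
        (((g' j' ▷ i.top.obj) ⊗ₘ k' l') ≫ q) =
      tube p ((f j ≫ g j) ▷ i.redObj ≫ r ≫ o.redObj ◁ (f' j' ≫ g' j'))
        (i.blueObj ◁ (h l ≫ k l) ≫ s ≫ (h' l' ≫ k' l') ▷ o.blueObj) q := fun j j' l l' => by
    -- Everything inserted in the vertical lines is slid onto the two arc vertices, where each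
    -- projection meets its inclusion and the sums become identities.
    rw [MonoidalCategory.tensorHom_def', MonoidalCategory.tensorHom_def, ← Category.assoc,
      tube_slide_redBot, tube_slide_blueBot, Category.assoc, ← tube_slide_redTop,
      ← tube_slide_blueTop]
    simp
  have hr : ∑ j, ∑ j', (f j ≫ g j) ▷ i.redObj ≫ r ≫ o.redObj ◁ (f' j' ≫ g' j') = r := by
    simp only [← Preadditive.comp_sum, ← Preadditive.sum_comp, ← whiskerLeft_sum,
      ← sum_whiskerRight, hA, hA']
    simp
  have hs : ∑ l, ∑ l', i.blueObj ◁ (h l ≫ k l) ≫ s ≫ (h' l' ≫ k' l') ▷ o.blueObj = s := by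
    simp only [← Preadditive.comp_sum, ← Preadditive.sum_comp, ← whiskerLeft_sum,
      ← sum_whiskerRight, hB, hB']
    simp
  simp only [key, ← tube_sum_blue, ← tube_sum_red, hr, hs]

theorem blockStack_simpleTube {x x' y y' x₂ x₂' y₂ y₂' : Irr D}
    (p : o.bot.obj ⟶ (x.obj ⊗ c.bot.obj) ⊗ y.obj) (r : x.obj ⊗ c.redObj ⟶ o.redObj ⊗ x'.obj)
    (s : c.blueObj ⊗ y.obj ⟶ y'.obj ⊗ o.blueObj) (q : (x'.obj ⊗ c.top.obj) ⊗ y'.obj ⟶ o.top.obj)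
    (p₂ : c.bot.obj ⟶ (x₂.obj ⊗ i.bot.obj) ⊗ y₂.obj)
    (r₂ : x₂.obj ⊗ i.redObj ⟶ c.redObj ⊗ x₂'.obj)
    (s₂ : i.blueObj ⊗ y₂.obj ⟶ y₂'.obj ⊗ c.blueObj)
    (q₂ : (x₂'.obj ⊗ i.top.obj) ⊗ y₂'.obj ⟶ c.top.obj) :
    blockStack o c i (simpleTube x x' y y' p r s q) (simpleTube x₂ x₂' y₂ y₂' p₂ r₂ s₂ q₂) =
      tube (botStack _ _ _ _ _ _ _ p p₂) (redStack _ _ _ _ _ _ _ r r₂)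
        (blueStack _ _ _ _ _ _ _ s s₂) (topStack _ _ _ _ _ _ _ q q₂) := by
  simp only [blockStack, simpleTube, ofSimpleArcs, DirectSum.toModule_lof, LinearMap.flip_apply,
    LinearMap.compr₂_apply, diagramStack, TensorProduct.map₂_apply_tmul]
  rfl

variable {A A' B B' A₂ A₂' B₂ B₂' : D}

/-- The parallel move may be postponed until after stacking, here for the outer factor;
`blockStack_tube` then frees the inner one. -/
theorem blockStack_tube_simpleTube {x₂ x₂' y₂ y₂' : Irr D}
    (p : o.bot.obj ⟶ (A ⊗ c.bot.obj) ⊗ B) (r : A ⊗ c.redObj ⟶ o.redObj ⊗ A')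
    (s : c.blueObj ⊗ B ⟶ B' ⊗ o.blueObj) (q : (A' ⊗ c.top.obj) ⊗ B' ⟶ o.top.obj)
    (p₂ : c.bot.obj ⟶ (x₂.obj ⊗ i.bot.obj) ⊗ y₂.obj)
    (r₂ : x₂.obj ⊗ i.redObj ⟶ c.redObj ⊗ x₂'.obj)
    (s₂ : i.blueObj ⊗ y₂.obj ⟶ y₂'.obj ⊗ c.blueObj)
    (q₂ : (x₂'.obj ⊗ i.top.obj) ⊗ y₂'.obj ⟶ c.top.obj) :
    blockStack o c i (tube p r s q) (simpleTube x₂ x₂' y₂ y₂' p₂ r₂ s₂ q₂) =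
      tube (botStack _ _ _ _ _ _ _ p p₂) (redStack _ _ _ _ _ _ _ r r₂)
        (blueStack _ _ _ _ _ _ _ s s₂) (topStack _ _ _ _ _ _ _ q q₂) := by
  rw [tube_eq_resolvedTube, resolvedTube]
  simp only [map_sum, LinearMap.sum_apply, blockStack_simpleTube]
  -- The stacked arcs are resolved only in their outer tensor factor, which reproduces the sum
  -- coming from the outer tube.
  rw [← tube_resolution
    (f := fun j => (simpleDecomposition A).proj j ▷ x₂.obj)
    (g := fun j => (simpleDecomposition A).inj j ▷ x₂.obj)
    (by simp [← comp_whiskerRight, ← sum_whiskerRight, SimpleDecomposition.total])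
    (f' := fun j => (simpleDecomposition A').proj j ▷ x₂'.obj)
    (g' := fun j => (simpleDecomposition A').inj j ▷ x₂'.obj)
    (by simp [← comp_whiskerRight, ← sum_whiskerRight, SimpleDecomposition.total])
    (h := fun j => y₂.obj ◁ (simpleDecomposition B).proj j)
    (k := fun j => y₂.obj ◁ (simpleDecomposition B).inj j)
    (by simp [← MonoidalCategory.whiskerLeft_comp, ← whiskerLeft_sum, SimpleDecomposition.total])
    (h' := fun j => y₂'.obj ◁ (simpleDecomposition B').proj j)
    (k' := fun j => y₂'.obj ◁ (simpleDecomposition B').inj j)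
    (by simp [← MonoidalCategory.whiskerLeft_comp, ← whiskerLeft_sum, SimpleDecomposition.total])]
  refine Finset.sum_congr rfl fun j _ => Finset.sum_congr rfl fun j' _ =>
    Finset.sum_congr rfl fun l _ => Finset.sum_congr rfl fun l' _ => ?_
  rw [botStack_outer, redStack_outer, blueStack_outer, topStack_outer]

theorem blockStack_tube
    (p : o.bot.obj ⟶ (A ⊗ c.bot.obj) ⊗ B) (r : A ⊗ c.redObj ⟶ o.redObj ⊗ A')
    (s : c.blueObj ⊗ B ⟶ B' ⊗ o.blueObj) (q : (A' ⊗ c.top.obj) ⊗ B' ⟶ o.top.obj)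
    (p₂ : c.bot.obj ⟶ (A₂ ⊗ i.bot.obj) ⊗ B₂)
    (r₂ : A₂ ⊗ i.redObj ⟶ c.redObj ⊗ A₂')
    (s₂ : i.blueObj ⊗ B₂ ⟶ B₂' ⊗ c.blueObj)
    (q₂ : (A₂' ⊗ i.top.obj) ⊗ B₂' ⟶ c.top.obj) :
    blockStack o c i (tube p r s q) (tube p₂ r₂ s₂ q₂) =
      tube (botStack _ _ _ _ _ _ _ p p₂) (redStack _ _ _ _ _ _ _ r r₂)
        (blueStack _ _ _ _ _ _ _ s s₂) (topStack _ _ _ _ _ _ _ q q₂) := by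
  rw [tube_eq_resolvedTube p₂, resolvedTube]
  simp only [map_sum, blockStack_tube_simpleTube]
  rw [← tube_resolution
    (f := fun j => A ◁ (simpleDecomposition A₂).proj j)
    (g := fun j => A ◁ (simpleDecomposition A₂).inj j)
    (by simp [← MonoidalCategory.whiskerLeft_comp, ← whiskerLeft_sum, SimpleDecomposition.total])
    (f' := fun j => A' ◁ (simpleDecomposition A₂').proj j)
    (g' := fun j => A' ◁ (simpleDecomposition A₂').inj j)
    (by simp [← MonoidalCategory.whiskerLeft_comp, ← whiskerLeft_sum, SimpleDecomposition.total])
    (h := fun j => (simpleDecomposition B₂).proj j ▷ B)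
    (k := fun j => (simpleDecomposition B₂).inj j ▷ B)
    (by simp [← comp_whiskerRight, ← sum_whiskerRight, SimpleDecomposition.total])
    (h' := fun j => (simpleDecomposition B₂').proj j ▷ B')
    (k' := fun j => (simpleDecomposition B₂').inj j ▷ B')
    (by simp [← comp_whiskerRight, ← sum_whiskerRight, SimpleDecomposition.total])]
  refine Finset.sum_congr rfl fun j _ => Finset.sum_congr rfl fun j' _ =>
    Finset.sum_congr rfl fun l _ => Finset.sum_congr rfl fun l' _ => ?_
  rw [botStack_inner, redStack_inner, blueStack_inner, topStack_inner]

/-- Two tubes agree if a morphism of arcs carries the vertices of one to those of the other. -/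
theorem tube_congr {P P' Q Q' : D} (f : A ⟶ P) (f' : A' ⟶ P') (g : B ⟶ Q) (g' : B' ⟶ Q')
    {p : o.bot.obj ⟶ (A ⊗ i.bot.obj) ⊗ B} {r : A ⊗ i.redObj ⟶ o.redObj ⊗ A'}
    {s : i.blueObj ⊗ B ⟶ B' ⊗ o.blueObj} {q : (A' ⊗ i.top.obj) ⊗ B' ⟶ o.top.obj}
    {p₁ : o.bot.obj ⟶ (P ⊗ i.bot.obj) ⊗ Q} {r₁ : P ⊗ i.redObj ⟶ o.redObj ⊗ P'}
    {s₁ : i.blueObj ⊗ Q ⟶ Q' ⊗ o.blueObj} {q₁ : (P' ⊗ i.top.obj) ⊗ Q' ⟶ o.top.obj}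
    (hp : p ≫ (f ▷ i.bot.obj ⊗ₘ g) = p₁) (hr : r ≫ o.redObj ◁ f' = f ▷ i.redObj ≫ r₁)
    (hs : s ≫ g' ▷ o.blueObj = i.blueObj ◁ g ≫ s₁) (hq : q = (f' ▷ i.top.obj ⊗ₘ g') ≫ q₁) :
    tube p r s q = tube p₁ r₁ s₁ q₁ := by
  rw [← hp, hq, MonoidalCategory.tensorHom_def', MonoidalCategory.tensorHom_def, ← Category.assoc,
    tube_slide_blueBot, tube_slide_redBot, Category.assoc, ← tube_slide_blueTop,
    ← tube_slide_redTop, hr, hs]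

/-- By linearity all three tubes may be taken simple. Neither bracketing then needs its arcs
resolved, and the associators on the arcs identify the results. -/
theorem blockStack_assoc {m₃ n₃ : ℕ} {e : TubeBoundary D m₃ n₃} (X : TubeBlock e o)
    (Y : TubeBlock o c) (Z : TubeBlock c i) :
    blockStack e c i (blockStack e o c X Y) Z = blockStack e o i X (blockStack o c i Y Z) := by
  induction X using TubeBlock.induction with
  | zero => simp
  | add X X' h h' => simp only [map_add, LinearMap.add_apply, h, h']
  | simple x x' y y' p r s q =>
  induction Y using TubeBlock.induction with
  | zero => simp
  | add X X' h h' => simp only [map_add, LinearMap.add_apply, h, h']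
  | simple x₂ x₂' y₂ y₂' p₂ r₂ s₂ q₂ =>
  induction Z using TubeBlock.induction with
  | zero => simp
  | add X X' h h' => simp only [map_add, h, h']
  | simple x₃ x₃' y₃ y₃' p₃ r₃ s₃ q₃ =>
  simp only [simpleTube_eq_tube, blockStack_tube]
  exact tube_congr (α_ _ _ _).hom (α_ _ _ _).hom (α_ _ _ _).inv (α_ _ _ _).inv
    (botStack_assoc _ _ _) (redStack_assoc _ _ _) (blueStack_assoc _ _ _) (topStack_assoc _ _ _)

/-- The straight tube with boundary labels `o`. -/
noncomputable def straightTube (o : TubeBoundary D m₂ n₂) : TubeBlock o o :=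
  parallelMove _ _ _ _ o o (straightDiagram o)

theorem straightTube_eq (o : TubeBoundary D m₂ n₂) :
    straightTube o = tube ((λ_ o.bot.obj).inv ≫ (ρ_ _).inv)
      ((λ_ o.redObj).hom ≫ (ρ_ o.redObj).inv) ((ρ_ o.blueObj).hom ≫ (λ_ o.blueObj).inv)
      ((ρ_ _).hom ≫ (λ_ o.top.obj).hom) :=
  rfl

theorem straightTube_blockStack (X : TubeBlock o i) : blockStack o o i (straightTube o) X = X := by
  induction X using TubeBlock.induction with
  | zero => simp
  | add X X' h h' => simp only [map_add, h, h']
  | simple x x' y y' p r s q =>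
  rw [simpleTube_eq_tube, straightTube_eq, blockStack_tube]
  exact tube_congr (λ_ _).hom (λ_ _).hom (ρ_ _).hom (ρ_ _).hom (botStack_leftUnit _)
    (redStack_leftUnit _) (blueStack_leftUnit _) (topStack_leftUnit _)

theorem blockStack_straightTube (X : TubeBlock o i) : blockStack o i i X (straightTube i) = X := by
  induction X using TubeBlock.induction with
  | zero => simp
  | add X X' h h' => simp only [map_add, LinearMap.add_apply, h, h']
  | simple x x' y y' p r s q =>
  rw [simpleTube_eq_tube, straightTube_eq, blockStack_tube]
  exact tube_congr (ρ_ _).hom (ρ_ _).hom (λ_ _).hom (λ_ _).hom (botStack_rightUnit _)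
    (redStack_rightUnit _) (blueStack_rightUnit _) (topStack_rightUnit _)

theorem tubeStack_apply (X : TubeSpace D m₁ m₂ n₁ n₂) (Y : TubeSpace D m₀ m₁ n₀ n₁)
    (o : TubeBoundary D m₂ n₂) (i : TubeBoundary D m₀ n₀) :
    tubeStack X Y o i = ∑ c, blockStack o c i (X o c) (Y c i) :=
  rfl

theorem tubeOne_self (o : TubeBoundary D m₂ n₂) : tubeOne D m₂ n₂ o o = straightTube o :=
  Pi.single_eq_same (M := fun i => TubeBlock o i) o _

theorem tubeOne_of_ne {o i : TubeBoundary D m₂ n₂} (h : i ≠ o) : tubeOne D m₂ n₂ o i = 0 :=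
  Pi.single_eq_of_ne (M := fun i => TubeBlock o i) h _

-- Over the boundary labels, stacking is matrix multiplication with `blockStack` as product of
-- entries, and the unit is the diagonal matrix of straight tubes.
variable (D) in
theorem tubeLaws : TubeLaws D where
  assoc X Y Z := by
    funext o i
    simp only [tubeStack_apply, map_sum, LinearMap.sum_apply, blockStack_assoc]
    exact Finset.sum_comm
  one_stack X := by
    funext o i
    rw [tubeStack_apply, Finset.sum_eq_single o, tubeOne_self, straightTube_blockStack]
    · intro c _ h
      rw [tubeOne_of_ne h, map_zero, LinearMap.zero_apply]
    · exact fun h => absurd (Finset.mem_univ o) h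
  stack_one X := by
    funext o i
    rw [tubeStack_apply, Finset.sum_eq_single i, tubeOne_self, blockStack_straightTube]
    · intro c _ h
      rw [tubeOne_of_ne h.symm, map_zero]
    · exact fun h => absurd (Finset.mem_univ i) h

end Stacking

/-! ### Morita contexts over arbitrary algebras. -/

section Morita

universe w

/-- A Morita context between the `k`-algebras `A` and `B`: bimodules `M` and `N` with compatible
associative pairings into `B` and `A`. -/
structure MoritaContext (k A B M N : Type*) [CommRing k] [Ring A] [Algebra k A] [Ring B]
    [Algebra k B] [AddCommGroup M] [Module k M] [Module B M] [Module Aᵐᵒᵖ M]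
    [AddCommGroup N] [Module k N] [Module A N] [Module Bᵐᵒᵖ N] where
  /-- the pairing into `B` -/
  left : M →ₗ[k] N →ₗ[k] B
  /-- the pairing into `A` -/
  right : N →ₗ[k] M →ₗ[k] A
  left_smul : ∀ (b : B) (x : M) (y : N), left (b • x) y = b * left x y
  left_balanced : ∀ (x : M) (a : A) (y : N), left (MulOpposite.op a • x) y = left x (a • y)
  left_op_smul : ∀ (x : M) (y : N) (b : B), left x (MulOpposite.op b • y) = left x y * b
  right_smul : ∀ (a : A) (y : N) (x : M), right (a • y) x = a * right y x
  right_balanced : ∀ (y : N) (b : B) (x : M), right (MulOpposite.op b • y) x = right y (b • x)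
  right_op_smul : ∀ (y : N) (x : M) (a : A), right y (MulOpposite.op a • x) = right y x * a
  left_smul_eq : ∀ (x : M) (y : N) (x' : M), left x y • x' = MulOpposite.op (right y x') • x
  right_smul_eq : ∀ (y : N) (x : M) (y' : N), right y x • y' = MulOpposite.op (left x y') • y

namespace MoritaContext

section

variable {k A B M N : Type*} [CommRing k] [Ring A] [Algebra k A] [Ring B]
    [Algebra k B] [AddCommGroup M] [Module k M] [Module B M] [Module Aᵐᵒᵖ M]
    [AddCommGroup N] [Module k N] [Module A N] [Module Bᵐᵒᵖ N] (C : MoritaContext k A B M N)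

/-- The Morita context with the roles of the two algebras exchanged. -/
@[simps]
def swap : MoritaContext k B A N M where
  left := C.right
  right := C.left
  left_smul := C.right_smul
  left_balanced := C.right_balanced
  left_op_smul := C.right_op_smul
  right_smul := C.left_smul
  right_balanced := C.left_balanced
  right_op_smul := C.left_op_smul
  left_smul_eq := C.right_smul_eq
  right_smul_eq := C.left_smul_eq

/-- The pairing into `B` is surjective. -/
def LeftSurjective : Prop :=
  ∃ (ι : Type) (_ : Fintype ι) (x : ι → M) (y : ι → N), ∑ i, C.left (x i) (y i) = 1

/-- The pairing into `B` induces an isomorphism from the balanced tensor product if it is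
surjective. -/
theorem exists_balancedTensor_equiv [IsScalarTower k B M] (h : C.LeftSurjective) :
    ∃ e : BalancedTensor k A M N ≃ₗ[k] B, ∀ x y, e (.tmul k A x y) = C.left x y := by
  obtain ⟨ι, _, x, y, hxy⟩ := h
  have tmul_sum' : ∀ (m : M) (n : ι → N),
      BalancedTensor.tmul k A m (∑ i, n i) = ∑ i, BalancedTensor.tmul k A m (n i) := fun m n => by
    simp only [BalancedTensor.tmul, tmul_sum, ← Submodule.mkQ_apply, map_sum]
  have balanced : ∀ (m : M) (a : A) (n : N),
      BalancedTensor.tmul k A (MulOpposite.op a • m) n = BalancedTensor.tmul k A m (a • n) :=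
    fun m a n => (Submodule.Quotient.eq _).2 (Submodule.subset_span ⟨m, a, n, rfl⟩)
  let f : BalancedTensor k A M N →ₗ[k] B := Submodule.liftQ _ (TensorProduct.lift C.left) (by
    rw [Submodule.span_le]
    rintro _ ⟨m, a, n, rfl⟩
    simp [C.left_balanced])
  have hf : ∀ m n, f (.tmul k A m n) = C.left m n := fun m n => rfl
  -- The inverse is dictated by `B`-linearity and the chosen expression of `1`: it sends `b` to the
  -- sum of the classes of `b • x i ⊗ y i`.
  let g : B →ₗ[k] BalancedTensor k A M N := ∑ i, (Submodule.mkQ _).comp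
    (((TensorProduct.mk k M N).flip (y i)).comp (LinearMap.toSpanSingleton B M (x i)
      |>.restrictScalars k))
  have hg : ∀ b, g b = ∑ i, BalancedTensor.tmul k A (b • x i) (y i) := fun b => by
    simp [g, BalancedTensor.tmul]
  refine ⟨LinearEquiv.ofLinearMap f g ?_ ?_, hf⟩
  · ext b
    simp only [LinearMap.comp_apply, hg, map_sum, hf, C.left_smul, ← Finset.mul_sum, hxy, mul_one,
      LinearMap.id_apply]
  · refine Submodule.linearMap_qext _ (TensorProduct.ext' fun m n => ?_)
    change g (f (.tmul k A m n)) = .tmul k A m n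
    -- Mixed associativity turns `left m n • x i` into `m` times `right n (x i)`. This scalar
    -- crosses the balanced tensor product and becomes `left (x i) (y i)` acting on `n`, and these
    -- sum to `1`.
    simp only [hf, hg, C.left_smul_eq, balanced, C.right_smul_eq, ← tmul_sum', ← Finset.sum_smul,
      ← Finset.op_sum, hxy, MulOpposite.op_one, one_smul]

end

section

variable (A B N : Type w) [Ring A] [Ring B] [AddCommGroup N] [Module A N] [Module Bᵐᵒᵖ N]
  [SMulCommClass A Bᵐᵒᵖ N]

/-- The `B`-module of `A`-linear maps out of an `A`-`B`-bimodule. -/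
def BimoduleHom (X : Type w) [AddCommGroup X] [Module A X] : Type w := N →ₗ[A] X

variable {A B N} {X Y : Type w} [AddCommGroup X] [Module A X] [AddCommGroup Y] [Module A Y]

instance : AddCommGroup (BimoduleHom A N X) := inferInstanceAs (AddCommGroup (N →ₗ[A] X))

instance : FunLike (BimoduleHom A N X) N X := inferInstanceAs (FunLike (N →ₗ[A] X) N X)

instance : LinearMapClass (BimoduleHom A N X) A N X :=
  inferInstanceAs (LinearMapClass (N →ₗ[A] X) A N X)

@[ext]
theorem BimoduleHom.ext {φ ψ : BimoduleHom A N X} (h : ∀ n, φ n = ψ n) : φ = ψ :=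
  LinearMap.ext h

instance : Module B (BimoduleHom A N X) where
  smul b φ :=
    ({ toFun := fun n => φ (MulOpposite.op b • n)
       map_add' := fun n n' => by rw [smul_add, map_add]
       map_smul' := fun a n => by rw [← smul_comm, map_smul, RingHom.id_apply] } : N →ₗ[A] X)
  one_smul φ := BimoduleHom.ext fun n => congrArg φ (one_smul Bᵐᵒᵖ n)
  mul_smul b c φ := BimoduleHom.ext fun n => congrArg φ (mul_smul (MulOpposite.op c)
    (MulOpposite.op b) n)
  smul_zero _ := rfl
  smul_add _ _ _ := rfl
  add_smul b c φ := BimoduleHom.ext fun n =>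
    (congrArg φ (add_smul (MulOpposite.op b) (MulOpposite.op c) n)).trans (map_add φ _ _)
  zero_smul φ := BimoduleHom.ext fun n =>
    (congrArg φ (zero_smul Bᵐᵒᵖ n)).trans (map_zero φ)

theorem BimoduleHom.smul_apply (b : B) (φ : BimoduleHom A N X) (n : N) :
    (b • φ) n = φ (MulOpposite.op b • n) := rfl

variable (B) in
/-- Composition with an `A`-linear map. -/
def BimoduleHom.map (f : X →ₗ[A] Y) : BimoduleHom A N X →ₗ[B] BimoduleHom A N Y where
  toFun φ := (f.comp φ : N →ₗ[A] Y)
  map_add' φ ψ := BimoduleHom.ext fun n => map_add f (φ n) (ψ n)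
  map_smul' _ _ := rfl

variable (A B N) in
/-- The functor from `A`-modules to `B`-modules represented by an `A`-`B`-bimodule. -/
def bimoduleHomFunctor : ModuleCat.{w} A ⥤ ModuleCat.{w} B where
  obj X := ModuleCat.of B (BimoduleHom A N X)
  map f := ModuleCat.ofHom (BimoduleHom.map B f.hom)

end

variable {k : Type*} {A B M N : Type w} [CommRing k] [Ring A] [Algebra k A] [Ring B]
    [Algebra k B] [AddCommGroup M] [Module k M] [Module B M] [Module Aᵐᵒᵖ M]
    [AddCommGroup N] [Module k N] [Module A N] [Module Bᵐᵒᵖ N] (C : MoritaContext k A B M N)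
    [SMulCommClass B Aᵐᵒᵖ M] [SMulCommClass A Bᵐᵒᵖ N]

/-- The map from a module to its double dual along a Morita context. -/
def bidual (X : Type w) [AddCommGroup X] [Module A X] :
    X →ₗ[A] BimoduleHom B M (BimoduleHom A N X) where
  toFun x :=
    ({ toFun := fun m =>
        ({ toFun := fun n => C.right n m • x
           map_add' := fun n n' => by rw [map_add, LinearMap.add_apply, add_smul]
           map_smul' := fun a n => by rw [C.right_smul, mul_smul, RingHom.id_apply] } : N →ₗ[A] X)
       map_add' := fun m m' => BimoduleHom.ext fun n => by
        change C.right n (m + m') • x = C.right n m • x + C.right n m' • x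
        rw [map_add, add_smul]
       map_smul' := fun b m => BimoduleHom.ext fun n => by
        change C.right n (b • m) • x = C.right (MulOpposite.op b • n) m • x
        rw [C.right_balanced] } : M →ₗ[B] BimoduleHom A N X)
  map_add' x x' := BimoduleHom.ext fun m => BimoduleHom.ext fun n => smul_add (C.right n m) x x'
  map_smul' a x := BimoduleHom.ext fun m => BimoduleHom.ext fun n => by
    change C.right n m • a • x = C.right n (MulOpposite.op a • m) • x
    rw [C.right_op_smul, mul_smul]

theorem bidual_apply (X : Type w) [AddCommGroup X] [Module A X] (x : X) (m : M) (n : N) :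
    C.bidual X x m n = C.right n m • x := rfl

/-- When the `right (n i) (m i)` sum to `1`, summing the values of the double dual at the pairs `(m
i, n i)` recovers `x`. The same sum, formed for an arbitrary `φ`, is its preimage. -/
theorem bidual_bijective (h : C.swap.LeftSurjective) (X : Type w) [AddCommGroup X] [Module A X] :
    Function.Bijective (C.bidual X) := by
  obtain ⟨ι, _, n, m, hnm⟩ := h
  rw [swap_left] at hnm
  constructor
  · rw [injective_iff_map_eq_zero]
    intro x hx
    rw [← one_smul A x, ← hnm, Finset.sum_smul]
    refine Finset.sum_eq_zero fun i _ => ?_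
    rw [← C.bidual_apply, hx]
    rfl
  · intro φ
    refine ⟨∑ i, φ (m i) (n i), BimoduleHom.ext fun m' => BimoduleHom.ext fun n' => ?_⟩
    rw [bidual_apply, Finset.smul_sum]
    -- Both linearities of `φ` and both mixed associativity laws carry the scalar of `(n', m')` over
    -- to that of `(n i, m i)`, acting on `m'`.
    have key : ∀ i, C.right n' m' • φ (m i) (n i) =
        φ (MulOpposite.op (C.right (n i) (m i)) • m') n' := fun i => by
      rw [← map_smul, C.right_smul_eq, ← BimoduleHom.smul_apply, ← map_smul, C.left_smul_eq]
    have sum_apply : ∀ f : ι → BimoduleHom A N X, (∑ i, f i) n' = ∑ i, f i n' := fun f =>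
      LinearMap.sum_apply (M := N) (M₂ := X) _ f n'
    simp only [key, ← sum_apply, ← map_sum, ← Finset.sum_smul, ← Finset.op_sum, hnm,
      MulOpposite.op_one, one_smul]

/-- The natural isomorphism from a module to its double dual. -/
noncomputable def bidualIso (h : C.swap.LeftSurjective) :
    𝟭 (ModuleCat.{w} A) ≅ bimoduleHomFunctor A B N ⋙ bimoduleHomFunctor B A M :=
  NatIso.ofComponents
    (fun X => (LinearEquiv.ofBijective (C.bidual X) (C.bidual_bijective h X)).toModuleIso)
    (fun {X Y} f => by
      ext x
      refine BimoduleHom.ext fun m => BimoduleHom.ext fun n => ?_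
      exact (map_smul f.hom (C.right n m) x).symm)

open scoped ModuleCat.Algebra in
/-- Algebras related by a Morita context with surjective pairings are Morita equivalent. -/
theorem isMoritaEquivalent [IsScalarTower k A N] [IsScalarTower k Bᵐᵒᵖ N]
    (h : C.LeftSurjective) (h' : C.swap.LeftSurjective) : IsMoritaEquivalent k A B := by
  let e : ModuleCat.{w} A ≌ ModuleCat.{w} B :=
    CategoryTheory.Equivalence.mk (bimoduleHomFunctor A B N) (bimoduleHomFunctor B A M)
      (C.bidualIso h') (C.swap.bidualIso h).symm
  have : e.functor.Linear k := ⟨fun {X Y} f c => by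
    ext φ
    refine BimoduleHom.ext fun n => ?_
    let ψ : BimoduleHom A N X := φ
    -- On the target, `c` acts through `B` and hence through the right action on `N`; the scalar
    -- towers identify this with its action through `A`.
    have hn : algebraMap k A c • n = MulOpposite.op (algebraMap k B c) • n := by
      rw [← MulOpposite.algebraMap_apply, algebraMap_smul, algebraMap_smul]
    change algebraMap k A c • f.hom (ψ n) = f.hom (ψ (MulOpposite.op (algebraMap k B c) • n))
    rw [← hn, map_smul ψ, map_smul f.hom]⟩
  exact ⟨⟨e, this⟩⟩

end MoritaContext

end Morita

/-! ### Straight tubes factor through any numbers of legs. -/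

section Factorization

variable {D : Type u} [Category.{v} D] [Abelian D] [Linear ℂ D] [MonoidalCategory D]
  [MonoidalPreadditive D] [MonoidalLinear ℂ D] [RigidCategory D] [IsMultifusion D]

/-- The identity of the tensor unit factors through products of `s` red legs. -/
theorem exists_unit_through_redProd (s : ℕ) :
    ∃ (ι : Type) (_ : Fintype ι) (a : ι → Fin s → Irr D) (f : ∀ j, 𝟙_ D ⟶ redProd s (a j))
      (g : ∀ j, redProd s (a j) ⟶ 𝟙_ D), ∑ j, f j ≫ g j = 𝟙 (𝟙_ D) := by
  induction s with
  | zero => exact ⟨Unit, inferInstance, fun _ => Fin.elim0, fun _ => 𝟙 (𝟙_ D), fun _ => 𝟙 (𝟙_ D),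
      (Fintype.sum_unique _).trans (Category.comp_id _)⟩
  | succ s ih =>
    obtain ⟨ι, _, a, f, g, h⟩ := ih
    -- The unit is first split as `𝟙_ D ⊗ 𝟙_ D`. As it need not be simple, the additional leg runs
    -- over its simple summands.
    let d := simpleDecomposition (𝟙_ D)
    refine ⟨ι × Fin d.n, inferInstance, fun x => Fin.cons (d.label x.2) (a x.1),
      fun x => (λ_ (𝟙_ D)).inv ≫ (f x.1 ⊗ₘ d.proj x.2),
      fun x => (g x.1 ⊗ₘ d.inj x.2) ≫ (λ_ (𝟙_ D)).hom, ?_⟩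
    have key : ∀ j l, ((λ_ (𝟙_ D)).inv ≫ (f j ⊗ₘ d.proj l)) ≫ (g j ⊗ₘ d.inj l) ≫ (λ_ (𝟙_ D)).hom =
        (λ_ (𝟙_ D)).inv ≫ ((f j ≫ g j) ⊗ₘ (d.proj l ≫ d.inj l)) ≫ (λ_ (𝟙_ D)).hom := by
      intro j l
      simp only [Category.assoc, tensorHom_comp_tensorHom_assoc]
    refine (Fintype.sum_prod_type _).trans ?_
    refine (Finset.sum_congr rfl fun j _ => Finset.sum_congr rfl fun l _ => key j l).trans ?_
    simp only [← Preadditive.comp_sum, ← Preadditive.sum_comp, ← tensor_sum, ← sum_tensor, h,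
      d.total]
    simp

/-- The identity of the tensor unit factors through products of `t` blue legs. -/
theorem exists_unit_through_blueProd (t : ℕ) :
    ∃ (ι : Type) (_ : Fintype ι) (b : ι → Fin t → Irr D) (f : ∀ j, 𝟙_ D ⟶ blueProd t (b j))
      (g : ∀ j, blueProd t (b j) ⟶ 𝟙_ D), ∑ j, f j ≫ g j = 𝟙 (𝟙_ D) := by
  induction t with
  | zero => exact ⟨Unit, inferInstance, fun _ => Fin.elim0, fun _ => 𝟙 (𝟙_ D), fun _ => 𝟙 (𝟙_ D),
      (Fintype.sum_unique _).trans (Category.comp_id _)⟩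
  | succ t ih =>
    obtain ⟨ι, _, b, f, g, h⟩ := ih
    let d := simpleDecomposition (𝟙_ D)
    refine ⟨ι × Fin d.n, inferInstance, fun x => Fin.cons (d.label x.2) (b x.1),
      fun x => (λ_ (𝟙_ D)).inv ≫ (d.proj x.2 ⊗ₘ f x.1),
      fun x => (d.inj x.2 ⊗ₘ g x.1) ≫ (λ_ (𝟙_ D)).hom, ?_⟩
    have key : ∀ j l, ((λ_ (𝟙_ D)).inv ≫ (d.proj l ⊗ₘ f j)) ≫ (d.inj l ⊗ₘ g j) ≫ (λ_ (𝟙_ D)).hom =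
        (λ_ (𝟙_ D)).inv ≫ ((d.proj l ≫ d.inj l) ⊗ₘ (f j ≫ g j)) ≫ (λ_ (𝟙_ D)).hom := by
      intro j l
      simp only [Category.assoc, tensorHom_comp_tensorHom_assoc]
    refine (Fintype.sum_prod_type _).trans ?_
    refine (Finset.sum_congr rfl fun j _ => Finset.sum_congr rfl fun l _ => key j l).trans ?_
    simp only [← Preadditive.comp_sum, ← Preadditive.sum_comp, ← tensor_sum, ← sum_tensor, h,
      d.total]
    simp

/-- The arc of the outer tube closes the legs `E` by `g` and then emits `C` from a coevaluation; the
inner one creates `E` by `f` and carries `C` upwards. The composite is half of a snake next to `f ≫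
g`. -/
theorem redStack_zigzag {C E : D} (f : 𝟙_ D ⟶ E) (g : E ⟶ 𝟙_ D) :
    redStack (𝟙_ D) Cᘁ (𝟙_ D) C C E C ((λ_ E).hom ≫ g ≫ η_ C Cᘁ) (f ▷ C) =
      (λ_ (𝟙_ D)).hom ▷ C ≫ (f ≫ g) ▷ C ≫ η_ C Cᘁ ▷ C ≫ (α_ _ _ _).hom := by
  rw [redStack_apply]
  monoidal

theorem blueStack_zigzag {C G : D} (f : 𝟙_ D ⟶ G) (g : G ⟶ 𝟙_ D) :
    blueStack (𝟙_ D) (ᘁC) (𝟙_ D) C C G C ((ρ_ G).hom ≫ g ≫ η_ (ᘁC) C) (C ◁ f) =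
      C ◁ (ρ_ (𝟙_ D)).hom ≫ C ◁ (f ≫ g) ≫ C ◁ η_ (ᘁC) C ≫ (α_ _ _ _).inv := by
  rw [blueStack_apply]
  monoidal

/-- Straight tubes factor through boundaries with any numbers of legs. -/
theorem exists_straightTube_eq_sum {m n : ℕ} (o : TubeBoundary D m n) (s t : ℕ) :
    ∃ (ι : Type) (_ : Fintype ι) (c : ι → TubeBoundary D s t) (X : ∀ j, TubeBlock o (c j))
      (Y : ∀ j, TubeBlock (c j) o), ∑ j, blockStack o (c j) o (X j) (Y j) = straightTube o := by
  obtain ⟨ι, _, a, f, g, h⟩ := exists_unit_through_redProd (D := D) s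
  obtain ⟨κ, _, b, f', g', h'⟩ := exists_unit_through_blueProd (D := D) t
  let C := o.redObj
  let B := o.blueObj
  let d := simpleDecomposition ((C ⊗ o.top.obj) ⊗ B)
  -- The inner tube brings `C` and `B` to the upper vertical line, so the middle upper edge runs
  -- over the summands of `(C ⊗ o.top.obj) ⊗ B`. Both arcs start at the unit, so the lower edge is
  -- unchanged.
  let c : ι × κ × Fin d.n → TubeBoundary D s t := fun x =>
    ⟨a x.1, b x.2.1, d.label x.2.2, o.bot⟩
  -- The strands arriving from the inner tube are paired with the dual strands left on the arcs of
  -- the outer tube.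
  let Q : ((Cᘁ ⊗ C) ⊗ o.top.obj) ⊗ (B ⊗ ᘁB) ⟶ o.top.obj :=
    (ε_ C Cᘁ ▷ o.top.obj ⊗ₘ ε_ (ᘁB) B) ≫ (ρ_ _).hom ≫ (λ_ _).hom
  let p : o.bot.obj ⟶ (𝟙_ D ⊗ o.bot.obj) ⊗ 𝟙_ D := (λ_ o.bot.obj).inv ≫ (ρ_ _).inv
  let X : ∀ x, TubeBlock o (c x) := fun x => tube (A := 𝟙_ D) (A' := Cᘁ) (B := 𝟙_ D) (B' := ᘁB) p
    ((λ_ (redProd s (a x.1))).hom ≫ g x.1 ≫ η_ C Cᘁ)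
    ((ρ_ (blueProd t (b x.2.1))).hom ≫ g' x.2.1 ≫ η_ (ᘁB) B)
    ((Cᘁ ◁ d.inj x.2.2) ▷ (ᘁB) ≫ (nestIso Cᘁ C o.top.obj B (ᘁB)).inv ≫ Q)
  let Y : ∀ x, TubeBlock (c x) o := fun x => tube (A := 𝟙_ D) (A' := C) (B := 𝟙_ D) (B' := B) p
    (f x.1 ▷ C) (B ◁ f' x.2.1) (d.proj x.2.2)
  refine ⟨_, inferInstance, c, X, Y, ?_⟩
  have key : ∀ j k l, blockStack o (c (j, k, l)) o (X (j, k, l)) (Y (j, k, l)) =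
      tube (botStack _ _ _ _ _ _ _ p p)
        ((λ_ (𝟙_ D)).hom ▷ C ≫ (f j ≫ g j) ▷ C ≫ η_ C Cᘁ ▷ C ≫ (α_ _ _ _).hom)
        (B ◁ (ρ_ (𝟙_ D)).hom ≫ B ◁ (f' k ≫ g' k) ≫ B ◁ η_ (ᘁB) B ≫ (α_ _ _ _).inv)
        ((nestIso Cᘁ C o.top.obj B (ᘁB)).hom ≫ (Cᘁ ◁ (d.proj l ≫ d.inj l)) ▷ (ᘁB) ≫
          (nestIso Cᘁ C o.top.obj B (ᘁB)).inv ≫ Q) := fun j k l => by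
    refine (blockStack_tube ..).trans ?_
    congr 1
    · exact redStack_zigzag (f j) (g j)
    · exact blueStack_zigzag (f' k) (g' k)
    · rw [topStack_apply]
      simp
  -- Each of the three indices occurs at one vertex only (red, blue, top), so the three resolutions
  -- of the identity collapse independently.
  simp only [Fintype.sum_prod_type, key, ← tube_sum_top, ← tube_sum_blue, ← tube_sum_red,
    ← Preadditive.comp_sum, ← Preadditive.sum_comp, ← whiskerLeft_sum, ← sum_whiskerRight, h, h',
    d.total]
  rw [straightTube_eq]
  -- Sliding the evaluations from the upper line onto the arcs completes the snakes, and the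
  -- triangle identities straighten the legs.
  refine tube_congr (λ_ _).hom (ε_ C Cᘁ) (ρ_ _).hom (ε_ (ᘁB) B) (botStack_leftUnit _) ?_ ?_ ?_
  · simp only [id_whiskerRight, Category.id_comp, Category.assoc]
    exact congrArg _ (ExactPairing.evaluation_coevaluation C Cᘁ)
  · simp only [MonoidalCategory.whiskerLeft_id, Category.id_comp, Category.assoc]
    exact congrArg _ (ExactPairing.coevaluation_evaluation (ᘁB) B)
  · simp [Q]

end Factorization

/-! ### The Morita context of tube bimodules. -/

section Context

variable {D : Type u} [Category.{v} D] [Abelian D] [Linear ℂ D] [MonoidalCategory D]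

/-- The element of the tube space with a single non-zero block. -/
noncomputable def tubeSingle {m₀ m₁ n₀ n₁ : ℕ} (o : TubeBoundary D m₁ n₁) (i : TubeBoundary D m₀ n₀)
    (X : TubeBlock o i) : TubeSpace D m₀ m₁ n₀ n₁ :=
  Pi.single o (Pi.single i X)

variable [MonoidalPreadditive D] [MonoidalLinear ℂ D] [RigidCategory D] [IsMultifusion D]
  {m₀ m₁ m₂ n₀ n₁ n₂ : ℕ}

theorem tubeStack_tubeSingle (o : TubeBoundary D m₂ n₂) (c : TubeBoundary D m₁ n₁)
    (i : TubeBoundary D m₀ n₀) (X : TubeBlock o c) (Y : TubeBlock c i) :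
    tubeStack (tubeSingle o c X) (tubeSingle c i Y) = tubeSingle o i (blockStack o c i X Y) := by
  funext o' i'
  rw [tubeStack_apply]
  by_cases ho : o' = o
  · subst ho
    rw [Finset.sum_eq_single c]
    · by_cases hi : i' = i
      · subst hi
        simp [tubeSingle]
      · simp [tubeSingle, hi]
    · intro c' _ hc
      simp [tubeSingle, hc]
    · exact fun h => absurd (Finset.mem_univ c) h
  · simp [tubeSingle, ho]

theorem tubeOne_eq_sum (m n : ℕ) :
    tubeOne D m n = ∑ o, tubeSingle o o (straightTube o) := by
  funext o
  rw [Finset.sum_apply, Finset.sum_eq_single o]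
  · simp [tubeSingle, tubeOne, straightTube]
  · intro c _ hc
    simp [tubeSingle, hc.symm]
  · exact fun h => absurd (Finset.mem_univ o) h

/-- The Morita context formed by the tube bimodules. -/
noncomputable def tubeMoritaContext (h : TubeLaws D) (m s n t : ℕ) :
    MoritaContext ℂ (TubeAlg h m n) (TubeAlg h s t) (TubeBimod h m s n t) (TubeBimod h s m t n)
      where
  left := (tubeStack : TubeSpace D m s n t →ₗ[ℂ] TubeSpace D s m t n →ₗ[ℂ] TubeSpace D s s t t)
  right := (tubeStack : TubeSpace D s m t n →ₗ[ℂ] TubeSpace D m s n t →ₗ[ℂ] TubeSpace D m m n n)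
  left_smul b x y := h.assoc b x y
  left_balanced x a y := h.assoc x a y
  left_op_smul x y b := (h.assoc x y b).symm
  right_smul b x y := h.assoc b x y
  right_balanced x a y := h.assoc x a y
  right_op_smul x y b := (h.assoc x y b).symm
  left_smul_eq x y x' := h.assoc x y x'
  right_smul_eq x y x' := h.assoc x y x'

/-- The unit is the sum of all straight tubes, and each of them factors through boundaries with `m`
red and `n` blue legs. -/
theorem tubeMoritaContext_leftSurjective (h : TubeLaws D) (m s n t : ℕ) :
    (tubeMoritaContext h m s n t).LeftSurjective := by
  choose ι _ c X Y hXY using fun o : TubeBoundary D s t => exists_straightTube_eq_sum o m n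
  -- The boundary labels live in `Type u`, while `LeftSurjective` requires an index in `Type`; hence
  -- the reindexing by `Fin`.
  let e := (Fintype.equivFin (Σ o, ι o)).symm
  refine ⟨_, inferInstance, fun j => tubeSingle (e j).1 (c _ (e j).2) (X _ (e j).2),
    fun j => tubeSingle (c _ (e j).2) (e j).1 (Y _ (e j).2), ?_⟩
  change ∑ j, tubeStack _ _ = tubeOne D s t
  simp only [tubeStack_tubeSingle]
  refine (e.sum_comp fun x => tubeSingle x.1 x.1
    (blockStack x.1 (c x.1 x.2) x.1 (X x.1 x.2) (Y x.1 x.2))).trans ?_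
  rw [Fintype.sum_sigma, tubeOne_eq_sum]
  refine Finset.sum_congr rfl fun o _ => ?_
  have : ∀ f : ι o → TubeBlock o o, ∑ j, tubeSingle o o (f j) = tubeSingle o o (∑ j, f j) :=
    fun f => (map_sum ((AddMonoidHom.single (fun o : TubeBoundary D s t => (i : TubeBoundary D s t)
      →
      TubeBlock o i) o).comp (AddMonoidHom.single (fun i => TubeBlock o i) o)) f Finset.univ).symm
  rw [this, hXY]

instance (h : TubeLaws D) (m s n t : ℕ) :
    SMulCommClass (TubeAlg h s t) (TubeAlg h m n)ᵐᵒᵖ (TubeBimod h m s n t) :=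
  ⟨fun a b X => (h.assoc a X b.unop).symm⟩

instance (h : TubeLaws D) (m s n t : ℕ) :
    IsScalarTower ℂ (TubeAlg h s t) (TubeBimod h m s n t) :=
  ⟨fun c a X => LinearMap.map_smul₂ (tubeStack (D := D)) c a X⟩

instance (h : TubeLaws D) (m s n t : ℕ) :
    IsScalarTower ℂ (TubeAlg h m n)ᵐᵒᵖ (TubeBimod h m s n t) :=
  ⟨fun c a X => map_smul (tubeStack (D := D) X) c a.unop⟩

theorem stackingIsBimoduleIso (h : TubeLaws D) (m s n t : ℕ) :
    StackingIsBimoduleIso h m s n t := by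
  obtain ⟨e, he⟩ := (tubeMoritaContext h m s n t).exists_balancedTensor_equiv
    (tubeMoritaContext_leftSurjective h m s n t)
  refine ⟨e, he, fun a X Y => ?_, fun a X Y => ?_⟩
  · rw [he, he, MoritaContext.left_smul]
  · rw [he, he, MoritaContext.left_op_smul]

/-- Exchanging `m, n` with `s, t` swaps the context, so surjectivity of one pairing for all indices
gives that of the other. -/
theorem tubeAlg_isMoritaEquivalent (h : TubeLaws D) (m s n t : ℕ) :
    IsMoritaEquivalent ℂ (TubeAlg h m n) (TubeAlg h s t) :=
  (tubeMoritaContext h m s n t).isMoritaEquivalent (tubeMoritaContext_leftSurjective h m s n t)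
    (tubeMoritaContext_leftSurjective h s m t n)

end Context

/-! ### Tubes without legs and the bulk tube algebra. -/

section Bulk

variable {D : Type u} [Category.{v} D] [Abelian D] [Linear ℂ D] [MonoidalCategory D]

/-- Boundaries without legs are given by their vertical edges. -/
@[simps]
def leglessBoundary : Irr D × Irr D ≃ TubeBoundary D 0 0 where
  toFun x := ⟨Fin.elim0, Fin.elim0, x.1, x.2⟩
  invFun o := (o.top, o.bot)
  left_inv _ := rfl
  right_inv _ := TubeBoundary.ext (Subsingleton.elim _ _) (Subsingleton.elim _ _) rfl rfl

/-- The bulk tube with given simple edges and vertices. -/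
noncomputable def simpleBulkTube {o i : Irr D × Irr D} (x y : Irr D)
    (p : o.2.obj ⟶ (x.obj ⊗ i.2.obj) ⊗ y.obj) (q : (x.obj ⊗ i.1.obj) ⊗ y.obj ⟶ o.1.obj) :
    BulkBlock o i :=
  DirectSum.lof ℂ (Irr D × Irr D) (fun k => BulkDiagram k.1.obj k.2.obj o i) (x, y) (p ⊗ₜ q)

theorem BulkBlock.induction {o i : Irr D × Irr D} {motive : BulkBlock o i → Prop} (zero : motive 0)
    (add : ∀ X Y, motive X → motive Y → motive (X + Y))
    (simple : ∀ (x y : Irr D) (p : o.2.obj ⟶ (x.obj ⊗ i.2.obj) ⊗ y.obj)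
      (q : (x.obj ⊗ i.1.obj) ⊗ y.obj ⟶ o.1.obj), motive (simpleBulkTube x y p q))
    (X : BulkBlock o i) : motive X := by
  refine DirectSum.induction_on X zero (fun k t => ?_) add
  change motive (DirectSum.lof ℂ (Irr D × Irr D) (fun k => BulkDiagram k.1.obj k.2.obj o i) k t)
  exact TensorProduct.induction_on t (by rwa [map_zero]) (fun p q => simple _ _ p q)
    (fun _ _ h₁ h₂ => by rw [map_add]; exact add _ _ h₁ h₂)

variable [MonoidalPreadditive D] [MonoidalLinear ℂ D]

/-- Absorbing a blue arc without legs into the upper vertical line. -/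
def absorbBlue (X Y Y' z : D) : (𝟙_ D ⊗ Y ⟶ Y' ⊗ 𝟙_ D) ⊗[ℂ] (X ⊗ Y' ⟶ z) →ₗ[ℂ] (X ⊗ Y ⟶ z) :=
  TensorProduct.lift (LinearMap.mk₂ ℂ
    (fun s q => (X ◁ ((λ_ Y).inv ≫ s ≫ (ρ_ Y').hom)) ≫ q)
    (by intros; simp) (by intros; simp) (by intros; simp) (by intros; simp))

/-- Absorbing a red arc without legs into the upper vertical line. -/
def absorbRed (X X' u Y z : D) :
    (X ⊗ 𝟙_ D ⟶ 𝟙_ D ⊗ X') ⊗[ℂ] ((X' ⊗ u) ⊗ Y ⟶ z) →ₗ[ℂ] ((X ⊗ u) ⊗ Y ⟶ z) :=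
  TensorProduct.lift (LinearMap.mk₂ ℂ
    (fun r q => (((ρ_ X).inv ≫ r ≫ (λ_ X').hom) ▷ u) ▷ Y ≫ q)
    (by intros; simp) (by intros; simp) (by intros; simp) (by intros; simp))

/-- The bulk tube obtained from a tube without legs. -/
noncomputable def tubeToBulkBlock (o i : TubeBoundary D 0 0) :
    TubeBlock o i →ₗ[ℂ] BulkBlock (o.top, o.bot) (i.top, i.bot) :=
  DirectSum.toModule ℂ _ _ fun k =>
    DirectSum.lof ℂ (Irr D × Irr D)
        (fun k => BulkDiagram k.1.obj k.2.obj (o.top, o.bot) (i.top, i.bot))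
        (k.redBot, k.blueBot) ∘ₗ
      TensorProduct.map LinearMap.id (absorbRed _ _ _ _ _ ∘ₗ
        TensorProduct.map LinearMap.id (absorbBlue _ _ _ _))

/-- The tube without legs obtained from a bulk tube. -/
noncomputable def bulkBlockToTube (o i : TubeBoundary D 0 0) :
    BulkBlock (o.top, o.bot) (i.top, i.bot) →ₗ[ℂ] TubeBlock o i :=
  DirectSum.toModule ℂ (Irr D × Irr D) (TubeBlock o i) fun k =>
    ofSimpleArcs k.1 k.1 k.2 k.2 ∘ₗ
      TensorProduct.map LinearMap.id
        (TensorProduct.mk ℂ (k.1.obj ⊗ i.redObj ⟶ o.redObj ⊗ k.1.obj) _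
            ((ρ_ k.1.obj).hom ≫ (λ_ k.1.obj).inv) ∘ₗ
          TensorProduct.mk ℂ (i.blueObj ⊗ k.2.obj ⟶ k.2.obj ⊗ o.blueObj) _
            ((λ_ k.2.obj).hom ≫ (ρ_ k.2.obj).inv))

variable [RigidCategory D] [IsMultifusion D]

theorem bulkToTube_apply (X : BulkTube D) (o i : TubeBoundary D 0 0) :
    bulkToTube X o i = bulkBlockToTube o i (X (o.top, o.bot) (i.top, i.bot)) :=
  rfl

variable {o c i : TubeBoundary D 0 0}

/-- The tube without legs whose arcs are labelled by arbitrary objects. -/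
noncomputable def leglessTube {A B : D} (p : o.bot.obj ⟶ (A ⊗ i.bot.obj) ⊗ B)
    (q : (A ⊗ i.top.obj) ⊗ B ⟶ o.top.obj) : TubeBlock o i :=
  tube p ((ρ_ A).hom ≫ (λ_ A).inv) ((λ_ B).hom ≫ (ρ_ B).inv) q

theorem bulkBlockToTube_simpleBulkTube (x y : Irr D) (p : o.bot.obj ⟶ (x.obj ⊗ i.bot.obj) ⊗ y.obj)
    (q : (x.obj ⊗ i.top.obj) ⊗ y.obj ⟶ o.top.obj) :
    bulkBlockToTube o i (simpleBulkTube (o := (o.top, o.bot)) (i := (i.top, i.bot)) x y p q) =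
      leglessTube p q := by
  refine Eq.trans ?_ (simpleTube_eq_tube x x y y p ((ρ_ x.obj).hom ≫ (λ_ x.obj).inv)
    ((λ_ y.obj).hom ≫ (ρ_ y.obj).inv) q)
  simp only [bulkBlockToTube, simpleBulkTube, DirectSum.toModule_lof]
  rfl

theorem tubeToBulkBlock_simpleTube (x x' y y' : Irr D)
    (p : o.bot.obj ⟶ (x.obj ⊗ i.bot.obj) ⊗ y.obj)
    (r : x.obj ⊗ 𝟙_ D ⟶ 𝟙_ D ⊗ x'.obj) (s : 𝟙_ D ⊗ y.obj ⟶ y'.obj ⊗ 𝟙_ D)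
    (q : (x'.obj ⊗ i.top.obj) ⊗ y'.obj ⟶ o.top.obj) :
    tubeToBulkBlock o i (simpleTube x x' y y' p r s q) =
      simpleBulkTube (o := (o.top, o.bot)) (i := (i.top, i.bot)) x y p
        (((ρ_ x.obj).inv ≫ r ≫ (λ_ x'.obj).hom) ▷ i.top.obj ▷ y.obj ≫
          (x'.obj ⊗ i.top.obj) ◁ ((λ_ y.obj).inv ≫ s ≫ (ρ_ y'.obj).hom) ≫ q) := by
  simp only [tubeToBulkBlock, simpleTube, ofSimpleArcs, DirectSum.toModule_lof]
  rfl

theorem tubeToBulkBlock_bulkBlockToTube (X : BulkBlock (o.top, o.bot) (i.top, i.bot)) :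
    tubeToBulkBlock o i (bulkBlockToTube o i X) = X := by
  induction X using BulkBlock.induction with
  | zero => simp
  | add X Y h h' => simp only [map_add, h, h']
  | simple x y p q =>
    rw [bulkBlockToTube_simpleBulkTube, leglessTube]
    refine (congrArg _ (simpleTube_eq_tube x x y y p _ _ q).symm).trans ?_
    refine (tubeToBulkBlock_simpleTube x x y y p ((ρ_ x.obj).hom ≫ (λ_ x.obj).inv)
      ((λ_ y.obj).hom ≫ (ρ_ y.obj).inv) q).trans ?_
    simp

/-- The arc vertices were absorbed into the upper line; sliding them back along the upper arc
segments restores the tube, even when the two ends of an arc have different labels. -/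
theorem bulkBlockToTube_tubeToBulkBlock (X : TubeBlock o i) :
    bulkBlockToTube o i (tubeToBulkBlock o i X) = X := by
  induction X using TubeBlock.induction with
  | zero => simp
  | add X Y h h' => simp only [map_add, h, h']
  | simple x x' y y' p r s q =>
    refine (congrArg _ (tubeToBulkBlock_simpleTube x x' y y' p r s q)).trans ?_
    rw [bulkBlockToTube_simpleBulkTube, simpleTube_eq_tube, leglessTube]
    change x.obj ⊗ 𝟙_ D ⟶ 𝟙_ D ⊗ x'.obj at r
    change 𝟙_ D ⊗ y.obj ⟶ y'.obj ⊗ 𝟙_ D at s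
    refine tube_congr (𝟙 _) ((ρ_ x.obj).inv ≫ r ≫ (λ_ x'.obj).hom) (𝟙 _)
      ((λ_ y.obj).inv ≫ s ≫ (ρ_ y'.obj).hom) (by simp) ?_ ?_ ?_
    · change ((ρ_ x.obj).hom ≫ (λ_ x.obj).inv) ≫ 𝟙_ D ◁ _ = 𝟙 x.obj ▷ 𝟙_ D ≫ r
      monoidal
    · change ((λ_ y.obj).hom ≫ (ρ_ y.obj).inv) ≫ _ ▷ 𝟙_ D = 𝟙_ D ◁ 𝟙 y.obj ≫ s
      simp
    · rw [MonoidalCategory.tensorHom_def, Category.assoc]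

/-- The bulk move resolves each arc once, the tube move at both of its ends. They agree because
projections and inclusions slide from the vertical lines onto the legless arc, where they sum to the
identity. -/
theorem bulkBlockToTube_bulkParallelMove {A B : D} (p : o.bot.obj ⟶ (A ⊗ i.bot.obj) ⊗ B)
    (q : (A ⊗ i.top.obj) ⊗ B ⟶ o.top.obj) :
    bulkBlockToTube o i (bulkParallelMove A B (o.top, o.bot) (i.top, i.bot) (p ⊗ₜ q)) =
      leglessTube p q := by
  let a := simpleDecomposition A
  let b := simpleDecomposition B
  have h₁ : bulkParallelMove A B (o.top, o.bot) (i.top, i.bot) (p ⊗ₜ q) =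
      ∑ j, ∑ l, simpleBulkTube (o := (o.top, o.bot)) (i := (i.top, i.bot)) (a.label j) (b.label l)
        (p ≫ ((a.proj j ▷ i.bot.obj) ⊗ₘ b.proj l)) (((a.inj j ▷ i.top.obj) ⊗ₘ b.inj l) ≫ q) := by
    simp only [bulkParallelMove, LinearMap.sum_apply]
    rfl
  have h₂ : ∀ j l, leglessTube (p ≫ ((a.proj j ▷ i.bot.obj) ⊗ₘ b.proj l))
      (((a.inj j ▷ i.top.obj) ⊗ₘ b.inj l) ≫ q) =
      tube p ((a.proj j ≫ a.inj j) ▷ i.redObj ≫ (ρ_ A).hom ≫ (λ_ A).inv)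
        (i.blueObj ◁ (b.proj l ≫ b.inj l) ≫ (λ_ B).hom ≫ (ρ_ B).inv) q := fun j l => by
    refine (tube_congr (a.proj j) (𝟙 _) (b.proj l) (𝟙 _) rfl
      (q := ((a.inj j ▷ i.top.obj) ⊗ₘ b.inj l) ≫ q)
      (r := a.proj j ▷ _ ≫ (ρ_ _).hom ≫ (λ_ _).inv) (s := _ ◁ b.proj l ≫ (λ_ _).hom ≫ (ρ_ _).inv)
      (by simp) (by simp) (by simp)).symm.trans ?_
    refine tube_congr (𝟙 _) (a.inj j) (𝟙 _) (b.inj l) (by simp) ?_ ?_ rfl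
    · change (a.proj j ▷ 𝟙_ D ≫ (ρ_ _).hom ≫ (λ_ _).inv) ≫ 𝟙_ D ◁ a.inj j =
        𝟙 A ▷ 𝟙_ D ≫ (a.proj j ≫ a.inj j) ▷ 𝟙_ D ≫ (ρ_ A).hom ≫ (λ_ A).inv
      simp
    · change (𝟙_ D ◁ b.proj l ≫ (λ_ _).hom ≫ (ρ_ _).inv) ≫ b.inj l ▷ 𝟙_ D =
        𝟙_ D ◁ 𝟙 B ≫ 𝟙_ D ◁ (b.proj l ≫ b.inj l) ≫ (λ_ B).hom ≫ (ρ_ B).inv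
      simp
  simp only [h₁, map_sum, bulkBlockToTube_simpleBulkTube, h₂, ← tube_sum_blue, ← tube_sum_red,
    ← Preadditive.sum_comp, ← whiskerLeft_sum, ← sum_whiskerRight]
  rw [SimpleDecomposition.total, SimpleDecomposition.total]
  simp [leglessTube]

theorem blockStack_leglessTube {A B A₂ B₂ : D} (p : o.bot.obj ⟶ (A ⊗ c.bot.obj) ⊗ B)
    (q : (A ⊗ c.top.obj) ⊗ B ⟶ o.top.obj) (p₂ : c.bot.obj ⟶ (A₂ ⊗ i.bot.obj) ⊗ B₂)
    (q₂ : (A₂ ⊗ i.top.obj) ⊗ B₂ ⟶ c.top.obj) :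
    blockStack o c i (leglessTube p q) (leglessTube p₂ q₂) =
      leglessTube (botStack _ _ _ _ _ _ _ p p₂) (topStack _ _ _ _ _ _ _ q q₂) := by
  refine (blockStack_tube ..).trans ?_
  rw [leglessTube]
  congr 1
  · change redStack A A A₂ A₂ (𝟙_ D) (𝟙_ D) (𝟙_ D) ((ρ_ A).hom ≫ (λ_ A).inv)
      ((ρ_ A₂).hom ≫ (λ_ A₂).inv) = (ρ_ (A ⊗ A₂)).hom ≫ (λ_ (A ⊗ A₂)).inv
    rw [redStack_apply]
    monoidal
  · change blueStack B B B₂ B₂ (𝟙_ D) (𝟙_ D) (𝟙_ D) ((λ_ B).hom ≫ (ρ_ B).inv)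
      ((λ_ B₂).hom ≫ (ρ_ B₂).inv) = (λ_ (B₂ ⊗ B)).hom ≫ (ρ_ (B₂ ⊗ B)).inv
    rw [blueStack_apply]
    monoidal

theorem bulkBlockToTube_bulkBlockStack (X : BulkBlock (o.top, o.bot) (c.top, c.bot))
    (Y : BulkBlock (c.top, c.bot) (i.top, i.bot)) :
    bulkBlockToTube o i (bulkBlockStack _ _ _ X Y) =
      blockStack o c i (bulkBlockToTube o c X) (bulkBlockToTube c i Y) := by
  induction X using BulkBlock.induction with
  | zero => simp
  | add X Y h h' => simp only [map_add, LinearMap.add_apply, h, h']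
  | simple x y p q =>
  induction Y using BulkBlock.induction with
  | zero => simp
  | add X Y h h' => simp only [map_add, h, h']
  | simple x₂ y₂ p₂ q₂ =>
  rw [bulkBlockToTube_simpleBulkTube, bulkBlockToTube_simpleBulkTube, blockStack_leglessTube,
    ← bulkBlockToTube_bulkParallelMove]
  simp only [bulkBlockStack, simpleBulkTube, DirectSum.toModule_lof, LinearMap.flip_apply,
    LinearMap.compr₂_apply, TensorProduct.map₂_apply_tmul]
  rfl

theorem bulkToTube_bulkMul (X Y : BulkTube D) :
    bulkToTube (bulkMul X Y) = tubeStack (bulkToTube X) (bulkToTube Y) := by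
  funext o i
  rw [tubeStack_apply, bulkToTube_apply, bulkMul, map_sum, ← leglessBoundary.sum_comp]
  exact Finset.sum_congr rfl fun c _ =>
    bulkBlockToTube_bulkBlockStack (c := leglessBoundary c) _ _

theorem bulkToTube_bulkOne : bulkToTube (bulkOne D) = tubeOne D 0 0 := by
  funext o i
  rw [bulkToTube_apply]
  by_cases h : i = o
  · subst h
    rw [tubeOne_self, straightTube_eq, bulkOne, Pi.single_eq_same, bulkBlockToTube_bulkParallelMove,
      leglessTube]
    congr 1
    · change (ρ_ (𝟙_ D)).hom ≫ (λ_ (𝟙_ D)).inv = (λ_ (𝟙_ D)).hom ≫ (ρ_ (𝟙_ D)).inv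
      -- The straight tube takes the unit for the legs and the legless tube takes it for the arc;
      -- the two unitors coincide on the unit object.
      rw [unitors_equal, unitors_inv_equal]
    · change (λ_ (𝟙_ D)).hom ≫ (ρ_ (𝟙_ D)).inv = (ρ_ (𝟙_ D)).hom ≫ (λ_ (𝟙_ D)).inv
      rw [unitors_equal, unitors_inv_equal]
  · rw [tubeOne_of_ne h, bulkOne, Pi.single_eq_of_ne, map_zero]
    exact fun h' => h (leglessBoundary.symm.injective h')

variable (D) in
theorem bulkToTube_bijective : Function.Bijective (bulkToTube (D := D)) := by
  constructor
  · rw [injective_iff_map_eq_zero]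
    intro X hX
    funext o i
    have := congrFun (congrFun hX (leglessBoundary o)) (leglessBoundary i)
    rw [bulkToTube_apply] at this
    exact (tubeToBulkBlock_bulkBlockToTube _).symm.trans
      ((congrArg (tubeToBulkBlock _ _) this).trans (map_zero _))
  · intro Z
    refine ⟨fun o i => tubeToBulkBlock (leglessBoundary o) (leglessBoundary i) (Z _ _), ?_⟩
    funext o i
    obtain ⟨o, rfl⟩ := leglessBoundary.surjective o
    obtain ⟨i, rfl⟩ := leglessBoundary.surjective i
    exact bulkBlockToTube_tubeToBulkBlock _

end Bulk

theorem mainTheorem6 (D : Type u) [Category.{v} D] [Abelian D] [Linear ℂ D] [MonoidalCategory D]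
    [MonoidalPreadditive D] [MonoidalLinear ℂ D] [RigidCategory D] [IsMultifusion D] :
    ∃ h : TubeLaws D,
      (∀ m s n t : ℕ,
        SMulCommClass (TubeAlg h s t) (TubeAlg h m n)ᵐᵒᵖ (TubeBimod h m s n t) ∧
        IsScalarTower ℂ (TubeAlg h s t) (TubeBimod h m s n t) ∧
        IsScalarTower ℂ (TubeAlg h m n)ᵐᵒᵖ (TubeBimod h m s n t)) ∧
      (∀ m s n t : ℕ, StackingIsBimoduleIso h m s n t ∧ StackingIsBimoduleIso h s m t n) ∧
      (∀ m s n t : ℕ, IsMoritaEquivalent ℂ (TubeAlg h m n) (TubeAlg h s t)) ∧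
      ∃ e : BulkTube D ≃ₗ[ℂ] TubeAlg h 0 0,
        (∀ X, e X = bulkToTube X) ∧ (∀ X Y, e (bulkMul X Y) = e X * e Y) ∧ e (bulkOne D) = 1 :=
  ⟨tubeLaws D, fun _ _ _ _ => ⟨inferInstance, inferInstance, inferInstance⟩,
    fun m s n t => ⟨stackingIsBimoduleIso _ m s n t, stackingIsBimoduleIso _ s m t n⟩,
    fun m s n t => tubeAlg_isMoritaEquivalent _ m s n t,
    LinearEquiv.ofBijective bulkToTube (bulkToTube_bijective D), fun _ => rfl,
    bulkToTube_bulkMul, bulkToTube_bulkOne⟩
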